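/- An infinite time Turing machine here has a finite set of states (among them an initial state and a limit state) and one tape, infinite to the right, whose squares hold symbols from $\{0,1\}$ ($0$ is the blank). Each instruction of the machine is determined by the current state and the scanned symbol; it writes a symbol, moves the head one square to the left or right (a left move on the first square leaves the head in place), and enters a new state. If there is no applicable instruction, the machine halts, and its configuration no longer changes. On input $x\in\mathbb{N}$ the machine starts in its initial state with the head on the first square and with $0\,1^x\,0\,0\,0\cdots$ on the tape. At each limit ordinal time a machine that has not halted is in its limit state, its head is on the first square, and each square holds $0$ if it has settled down to $0$ before that time, and $1$ otherwise (that is, if it has settled down to $1$, or has alternated between $0$ and $1$ unboundedly often). For a limit ordinal $\alpha$ let $\mathcal{P}(\alpha\text{-time Turing machine})$ be the set of all predicates $P$ on $\mathbb{N}$ for which there is an infinite time Turing machine such that, for every $x\in\mathbb{N}$, in its computation on input $x$ the first square holds at time $\alpha$ the symbol $1$ if $P(x)$ is true and $0$ if $P(x)$ is false. Let $\Sigma_1$ (respectively $\Pi_1$) be the class of relations on natural numbers of the form $\exists y\,R(\bar x,y)$ (respectively $\forall y\,R(\bar x,y)$) with $R$ recursive; for $m\ge 2$ let $\Sigma_m$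 (respectively $\Pi_m$) be the class of relations $\exists y\,R(\bar x,y)$ with $R$ in $\Pi_{m-1}$ (respectively $\forall y\,R(\bar x,y)$ with $R$ in $\Sigma_{m-1}$); and let $\Delta_m=\Sigma_m\cap\Pi_m$. Then for every integer $n\ge 1$, $$\mathcal{P}(\omega\cdot n\text{-time Turing machine})\supseteq\{P : P \text{ is a } \Delta_{n+1} \text{ predicate on } \mathbb{N}\}.$$ -/

import Mathlib

/-- An infinite time Turing machine with one tape, whose squares are numbered by `ℕ` (so the tape is
bounded on the left), over the alphabet `Bool` (`false` is the symbol 0, which is also the blank,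
and `true` is the symbol 1). An instruction `(b, d, q)` means: write `b`, move the head one square in
the direction `d`, and go to the state `q`; where there is no instruction, the machine halts. -/
structure InfiniteTimeTM where
  State : Type
  finite_state : Finite State
  initState : State
  limitState : State
  instr : State → Bool → Option (Bool × Turing.Dir × State)

namespace InfiniteTimeTM

/-- A configuration: the state, the position of the head, and the contents of the tape. -/
@[ext]
structure Config (M : InfiniteTimeTM) where
  state : M.State
  head : ℕ
  tape : ℕ → Bool

/-- Moving the head by one square. A left move on the first square leaves the head where it is. -/
def moveHead : Turing.Dir → ℕ → ℕ
  | Turing.Dir.left, i => i - 1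
  | Turing.Dir.right, i => i + 1

/-- One step of the machine; `none` if no instruction applies, i.e. if the machine has halted. -/
def step (M : InfiniteTimeTM) (c : M.Config) : Option M.Config :=
  (M.instr c.state (c.tape c.head)).map fun a =>
    { state := a.2.2
      head := moveHead a.2.1 c.head
      tape := Function.update c.tape c.head a.1 }

/-- The start on input `x`: the number `x` is written in unary as a 0 followed by `x` ones followed
by zeros, and the head is on the first square. -/
def init (M : InfiniteTimeTM) (x : ℕ) : M.Config where
  state := M.initState
  head := 0
  tape := fun i => decide (1 ≤ i ∧ i ≤ x)

open Classical in
/-- The contents at the limit time `l` of a square whose contents at the times `β < l` are `s β`: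
0 if the square has settled down to 0, and otherwise (i.e. if it has settled down to 1, or has
alternated between 0 and 1 unboundedly often) 1. -/
noncomputable def limitSymbol (l : Ordinal.{0}) (s : ∀ β, β < l → Bool) : Bool :=
  if ∃ β, β < l ∧ ∀ γ (hγ : γ < l), β ≤ γ → s γ hγ = false then false else true

open Classical in
/-- The configuration at the limit time `l`, given the configurations at all the earlier times. A
machine that has halted before keeps its configuration (which is the same at all times after
halting). Otherwise the machine goes into the limit state with its head on the first square. -/
noncomputable def limitConfig (M : InfiniteTimeTM) (l : Ordinal.{0})
    (c : ∀ β, β < l → M.Config) : M.Config :=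
  if h : ∃ β, ∃ hβ : β < l, M.step (c β hβ) = none then
    c h.choose h.choose_spec.choose
  else
    { state := M.limitState
      head := 0
      tape := fun i => limitSymbol l fun β hβ => (c β hβ).tape i }

/-- The configuration of the machine on input `x` at each ordinal time. -/
noncomputable def run (M : InfiniteTimeTM) (x : ℕ) (t : Ordinal.{0}) : M.Config :=
  Ordinal.limitRecOn t (M.init x) (fun _ c => (M.step c).getD c) (fun l _ c => M.limitConfig l c)

/-- The set of predicates over `ℕ` that are decided by `t`-time Turing machines: on each input `x`,
the first square of the tape holds at time `t` the symbol 1 if `P x` is true, and 0 otherwise. -/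
def predicatesDecidedInTime (t : Ordinal.{0}) : Set (ℕ → Prop) :=
  {P | ∃ M : InfiniteTimeTM, ∀ x : ℕ, (M.run x t).tape 0 = true ↔ P x}

end InfiniteTimeTM

namespace ArithmeticalHierarchy

/- `IsSigma n α R` and `IsPi n α R` say that the relation `R` on `α` (in practice `ℕ × ⋯ × ℕ`) is
`Σ_n`, resp. `Π_n`. At level 0 both are the recursive relations, so that `Σ_1` and `Π_1` consist of
the relations `∃ y, R (x, y)` and `∀ y, R (x, y)` with `R` recursive. -/
mutual

def IsSigma : ℕ → ∀ (α : Type) [Primcodable α], (α → Prop) → Prop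
  | 0, _, _, P => ComputablePred P
  | n + 1, α, _, P => ∃ R : α × ℕ → Prop, IsPi n (α × ℕ) R ∧ ∀ x, P x ↔ ∃ y, R (x, y)

def IsPi : ℕ → ∀ (α : Type) [Primcodable α], (α → Prop) → Prop
  | 0, _, _, P => ComputablePred P
  | n + 1, α, _, P => ∃ R : α × ℕ → Prop, IsSigma n (α × ℕ) R ∧ ∀ x, P x ↔ ∀ y, R (x, y)

end

/-- The set `Δ_n = Σ_n ∩ Π_n` of predicates over `ℕ`. -/
def deltaPredicates (n : ℕ) : Set (ℕ → Prop) :=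
  {P | IsSigma n ℕ P ∧ IsPi n ℕ P}

end ArithmeticalHierarchy

/-!
The idea is to prove more than is asked: every `Π_{n+1}` predicate is decided at the time `ω · n`. The
content of a square at a limit time is the limit superior of its earlier contents, so that one stage of
`ω` steps evaluates an existential quantifier for all arguments at once (a square is set to `1` as soon
as a witness has been found, and stays so), and the last stage, at whose end only the first square is
looked at, evaluates two quantifiers `∀ y, ∃ z`: it searches for a `z` for `y = 0, 1, 2, …` in turn and
makes the first square flash whenever it finds one.

Writing a `Π_{n+1}` predicate as `∀ y, ∃ z, ¬ Alternation a (n - 1) ⟨⟨x, y⟩, z⟩` with a recursive set `a`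
of codes (`exists_forall_exists_alternation`), the stages `0, …, n - 2` therefore compute tables of
`Alternation a 1, …, Alternation a (n - 1)`, where the table of `Alternation a (k + 1)` is obtained from
that of `Alternation a k`, and the stage `n - 1` performs the search. The argument `x` is needed in the
last stage only. This algorithm is written down as a `Controller`, a computable control unit with an
infinite bit memory, in `altController`; its correctness is `altController_stage_out`.

It remains to realize any such control unit by a machine with one binary tape (`exists_machine`), in
three steps. The control functions are computed by structured programs for a register machine, by
induction on `Nat.Partrec'` (`implements_of_partrec'`). These programs are compiled to a finite number
of instructions with jumps (`Prog.code`, `Runs`). The instructions are executed by a Turing machine on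
whose tape the memory and the registers, which are written in unary, occupy interleaved tracks
(`Represents`, `RepresentsReg`, `simulate_reach`). A limit stage spoils the registers. This is harmless
since the end of a register is its first `0`, so that all registers can be cleared by writing one
symbol on each of their tracks. The parts of the tape that matter are the memory and the output square.
In a step of the control unit only one of their squares changes, and only once, so that their limits
along the steps of the Turing machine are those along the steps of the control unit
(`represents_limit`).
-/

/-! ### Alternating quantifiers over codes -/

namespace ArithmeticalHierarchy

/-- The `k`-fold alternation of the quantifier prefix `∃ z, ¬` in front of the set of codes `a`.
The variables that are bound so far are collected in one number by means of `Nat.pair`. -/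
def Alternation (a : ℕ → Bool) : ℕ → ℕ → Prop
  | 0, i => a i = true
  | k + 1, i => ∃ z, ¬ Alternation a k (Nat.pair i z)

/-- A recursive relation is given by a recursive set of codes. -/
theorem exists_computable_code {α : Type} [Primcodable α] {P : α → Prop} (hP : ComputablePred P) :
    ∃ a : ℕ → Bool, Computable a ∧ ∀ x, a (Encodable.encode x) = true ↔ P x := by
  obtain ⟨hd, hc⟩ := hP
  have h : Computable₂ fun (_ : ℕ) (y : α) => decide (P y) := (hc.comp Computable.snd).to₂
  exact ⟨_, Computable.option_casesOn Computable.decode (Computable.const false) h, fun x => by simp⟩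

/-- A `Σ_n` relation, and the complement of a `Π_n` relation, is an `n`-fold alternation over a
recursive set of codes. -/
theorem exists_alternation (n : ℕ) :
    (∀ (α : Type) [Primcodable α] (P : α → Prop), IsSigma n α P →
      ∃ a : ℕ → Bool, Computable a ∧ ∀ x, P x ↔ Alternation a n (Encodable.encode x)) ∧
    (∀ (α : Type) [Primcodable α] (P : α → Prop), IsPi n α P →
      ∃ a : ℕ → Bool, Computable a ∧ ∀ x, ¬ P x ↔ Alternation a n (Encodable.encode x)) := by
  induction n with
  | zero =>
    refine ⟨fun α _ P h => ?_, fun α _ P h => ?_⟩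
    · rw [IsSigma] at h
      obtain ⟨a, ha, h⟩ := exists_computable_code h
      exact ⟨a, ha, fun x => (h x).symm⟩
    · rw [IsPi] at h
      obtain ⟨a, ha, h⟩ := exists_computable_code h.not
      exact ⟨a, ha, fun x => (h x).symm⟩
  | succ n ih =>
    refine ⟨fun α _ P h => ?_, fun α _ P h => ?_⟩
    · rw [IsSigma] at h
      obtain ⟨R, hR, hP⟩ := h
      obtain ⟨a, ha, h⟩ := ih.2 _ R hR
      refine ⟨a, ha, fun x => ?_⟩
      rw [hP, Alternation]
      refine exists_congr fun y => ?_
      have := h (x, y)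
      rw [Encodable.encode_prod_val, Encodable.encode_nat] at this
      rw [← this, not_not]
    · rw [IsPi] at h
      obtain ⟨R, hR, hP⟩ := h
      obtain ⟨a, ha, h⟩ := ih.1 _ R hR
      refine ⟨a, ha, fun x => ?_⟩
      rw [hP, Alternation, not_forall]
      refine exists_congr fun y => ?_
      have := h (x, y)
      rw [Encodable.encode_prod_val, Encodable.encode_nat] at this
      rw [← this]

/-- The normal form of a `Π_{n+2}` predicate, whose two outermost quantifiers are kept apart. -/
theorem exists_forall_exists_alternation {n : ℕ} {P : ℕ → Prop} (h : IsPi (n + 2) ℕ P) :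
    ∃ a : ℕ → Bool, Computable a ∧
      ∀ x, P x ↔ ∀ y, ∃ z, ¬ Alternation a n (Nat.pair (Nat.pair x y) z) := by
  obtain ⟨a, ha, h⟩ := (exists_alternation (n + 2)).2 ℕ P h
  refine ⟨a, ha, fun x => ?_⟩
  rw [← not_iff_not, h, Encodable.encode_nat]
  simp only [Alternation, not_exists, not_forall]

end ArithmeticalHierarchy

/-! ### Bit memories under computable control -/

open Classical in
/-- The limit superior of a sequence of bits. -/
noncomputable def boolLimsup (f : ℕ → Bool) : Bool :=
  decide (∀ N, ∃ j, N ≤ j ∧ f j = true)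

theorem boolLimsup_eq_true {f : ℕ → Bool} :
    boolLimsup f = true ↔ ∀ N, ∃ j, N ≤ j ∧ f j = true := by
  simp [boolLimsup]

theorem boolLimsup_eq_of_eventually {f : ℕ → Bool} {b : Bool} (N : ℕ) (h : ∀ j, N ≤ j → f j = b) :
    boolLimsup f = b := by
  rw [Bool.eq_iff_iff, boolLimsup_eq_true]
  constructor
  · intro hf
    obtain ⟨j, hj, hfj⟩ := hf N
    rw [← h j hj, hfj]
  · rintro rfl M
    exact ⟨max M N, le_max_left _ _, h _ (le_max_right _ _)⟩

/-- A control unit with states in `α`, attached to an infinite bit memory and to one output bit.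
In the control state `v` it reads the bit `b` with the address `readAddr v`, writes the bit
`writeBit (v, b)` at the address `writeAddr (v, b)`, where the address `0` stands for the output bit,
and goes to the control state `next (v, b)`. -/
structure Controller (α : Type) [Primcodable α] where
  start : ℕ → α
  readAddr : α → ℕ
  writeAddr : α × Bool → ℕ
  writeBit : α × Bool → Bool
  next : α × Bool → α
  computable_start : Computable start
  computable_readAddr : Computable readAddr
  computable_writeAddr : Computable writeAddr
  computable_writeBit : Computable writeBit
  computable_next : Computable next

namespace Controller

variable {α : Type} [Primcodable α]

/-- The bit memory together with the output bit. -/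
structure Store where
  mem : ℕ → Bool
  out : Bool

/-- Writing a bit, where the address `0` stands for the output bit. -/
def Store.write (s : Store) (i : ℕ) (b : Bool) : Store :=
  if i = 0 then { s with out := b } else { s with mem := Function.update s.mem i b }

/-- One step of the control unit. -/
def step (D : Controller α) (c : α × Store) : α × Store :=
  let w := (c.1, c.2.mem (D.readAddr c.1))
  (D.next w, c.2.write (D.writeAddr w) (D.writeBit w))

/-- The configuration after `j` steps, starting on the argument `x` with the store `s`. -/
def conf (D : Controller α) (x : ℕ) (s : Store) (j : ℕ) : α × Store :=
  D.step^[j] (D.start x, s)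

theorem conf_succ (D : Controller α) (x : ℕ) (s : Store) (j : ℕ) :
    D.conf x s (j + 1) = D.step (D.conf x s j) :=
  Function.iterate_succ_apply' _ _ _

/-- The store after infinitely many steps. -/
noncomputable def limit (D : Controller α) (x : ℕ) (s : Store) : Store where
  mem i := boolLimsup fun j => (D.conf x s j).2.mem i
  out := boolLimsup fun j => (D.conf x s j).2.out

/-- The store after `k` stages of infinitely many steps each. The control unit is restarted at the
beginning of each stage. -/
noncomputable def stage (D : Controller α) (x : ℕ) : ℕ → Store
  | 0 => ⟨fun _ => false, false⟩
  | k + 1 => D.limit x (stage D x k)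

end Controller

/-! ### A control unit for alternating quantifiers -/

namespace ArithmeticalHierarchy

/-- A search through all `y`, for each of which a `z` with `B y z` is looked for, is successful
infinitely often if and only if there is such a `z` for each `y`. -/
theorem frequently_search_iff {B : ℕ → ℕ → Prop} {p : ℕ → ℕ × ℕ} (h0 : p 0 = (0, 0))
    (hB : ∀ j, B (p j).1 (p j).2 → p (j + 1) = ((p j).1 + 1, 0))
    (hB' : ∀ j, ¬ B (p j).1 (p j).2 → p (j + 1) = ((p j).1, (p j).2 + 1)) :
    (∀ N, ∃ j, N ≤ j ∧ B (p j).1 (p j).2) ↔ ∀ y, ∃ z, B y z := by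
  constructor
  · intro h
    -- the values of `y` that have been left behind have witnesses
    have key : ∀ j, ∀ y < (p j).1, ∃ z, B y z := by
      intro j
      induction j with
      | zero => simp [h0]
      | succ j ih =>
        intro y hy
        by_cases hb : B (p j).1 (p j).2
        · rw [hB j hb] at hy
          rcases Nat.lt_succ_iff_lt_or_eq.1 hy with hy | rfl
          · exact ih y hy
          · exact ⟨_, hb⟩
        · rw [hB' j hb] at hy
          exact ih y hy
    have mono : Monotone fun j => (p j).1 := by
      refine monotone_nat_of_le_succ fun j => ?_
      by_cases hb : B (p j).1 (p j).2
      · simp [hB j hb]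
      · simp [hB' j hb]
    have unb : ∀ y, ∃ j, y ≤ (p j).1 := by
      intro y
      induction y with
      | zero => exact ⟨0, Nat.zero_le _⟩
      | succ y ih =>
        obtain ⟨j, hj⟩ := ih
        obtain ⟨i, hi, hb⟩ := h j
        refine ⟨i + 1, ?_⟩
        rw [hB i hb]
        exact Nat.succ_le_succ (hj.trans (mono hi))
    intro y
    obtain ⟨j, hj⟩ := unb (y + 1)
    exact key j y hj
  · intro h N
    by_contra! hN
    -- without further success, `z` runs through all numbers from some point on
    have tail : ∀ i, p (N + i) = ((p N).1, (p N).2 + i) := by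
      intro i
      induction i with
      | zero => simp
      | succ i ih => rw [← Nat.add_assoc, hB' _ (hN _ (Nat.le_add_right _ _)), ih, Nat.add_assoc]
    have key : ∀ j, ∀ z < (p j).2, ¬ B (p j).1 z := by
      intro j
      induction j with
      | zero => simp [h0]
      | succ j ih =>
        by_cases hb : B (p j).1 (p j).2
        · simp [hB j hb]
        · rw [hB' j hb]
          intro z hz
          rcases Nat.lt_succ_iff_lt_or_eq.1 hz with hz | rfl
          · exact ih z hz
          · exact hb
    obtain ⟨z, hz⟩ := h (p N).1
    rcases lt_or_ge z (p N).2 with hlt | hge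
    · exact key N z hlt hz
    · obtain ⟨i, rfl⟩ := Nat.exists_eq_add_of_le hge
      refine hN (N + i) (Nat.le_add_right _ _) ?_
      rw [tail]
      exact hz

/-- The control states: whether the number of the stage has been found out, the argument, the
number of the stage, and the code of the item that is dealt with next. -/
abbrev AltState := Bool × ℕ × ℕ × ℕ

/-- The address of the flag that is set in the stage `k`. -/
def flagAddr (k : ℕ) : ℕ := Nat.pair 0 k + 1

/-- The address of the truth value of `Alternation a k i`, for `1 ≤ k`. -/
def tableAddr (k i : ℕ) : ℕ := Nat.pair (k + 1) i + 1

/-- The code whose truth value is used next: in the last stage `l` the number `q` codes a pair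
`(y, z)` of values of the two outermost quantified variables. -/
def altItem (l : ℕ) (v : AltState) : ℕ :=
  if v.2.2.1 = l then Nat.pair (Nat.pair v.2.1 v.2.2.2.unpair.1) v.2.2.2.unpair.2 else v.2.2.2

/-- The truth value of `Alternation a k` at the current item in the stage `k`, where `b` is the bit
that has been read. -/
def altValue (a : ℕ → Bool) (l : ℕ) (w : AltState × Bool) : Bool :=
  if w.1.1 = true ∧ w.1.2.2.1 = 0 then a (altItem l w.1) else w.2

/-- The address that is read: a flag until the number of the stage is known, and then an entry of the
table of the stage. In the stage `0` the bit that is read is not used, since `a` is computed. -/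
def altReadAddr (l : ℕ) (v : AltState) : ℕ :=
  if v.1 = true then tableAddr v.2.2.1 (altItem l v) else flagAddr v.2.2.1

/-- The address that is written: the flag of the stage, or an entry of the table of the following
stage. The address `0` of the output bit is used in the last stage, and also if there is nothing to
write, because the output does not matter before the last stage. -/
def altWriteAddr (a : ℕ → Bool) (l : ℕ) (w : AltState × Bool) : ℕ :=
  if altValue a l w = true ∨ (w.1.1 = true ∧ w.1.2.2.1 = l) then 0
  else if w.1.1 = true then tableAddr (w.1.2.2.1 + 1) w.1.2.2.2.unpair.1
  else flagAddr w.1.2.2.1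

/-- The item that follows: in the last stage, the search for `z` is abandoned in favour of the
next `y` as soon as it is successful. -/
def altNextItem (a : ℕ → Bool) (l : ℕ) (w : AltState × Bool) : ℕ :=
  if w.1.2.2.1 = l then
    if altValue a l w = true then Nat.pair w.1.2.2.2.unpair.1 (w.1.2.2.2.unpair.2 + 1)
    else Nat.pair (w.1.2.2.2.unpair.1 + 1) 0
  else w.1.2.2.2 + 1

/-- The control state that follows: the flags are passed through up to the first one that is not set,
whose number is that of the stage. -/
def altNext (a : ℕ → Bool) (l : ℕ) (w : AltState × Bool) : AltState :=
  if w.1.1 = true then (true, w.1.2.1, w.1.2.2.1, altNextItem a l w)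
  else if w.2 = true then (false, w.1.2.1, w.1.2.2.1 + 1, 0)
  else (true, w.1.2.1, w.1.2.2.1, 0)

section Computability

variable {β : Type} [Primcodable β]

theorem computable_ite {p : β → Prop} [DecidablePred p] {γ : Type} [Primcodable γ] {f g : β → γ}
    (hp : Computable fun x => decide (p x)) (hf : Computable f) (hg : Computable g) :
    Computable fun x => if p x then f x else g x :=
  (Computable.cond hp hf hg).of_eq fun x => by by_cases h : p x <;> simp [h]

theorem computable_decide_and {p q : β → Prop} [DecidablePred p] [DecidablePred q]
    (hp : Computable fun x => decide (p x)) (hq : Computable fun x => decide (q x)) :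
    Computable fun x => decide (p x ∧ q x) :=
  (Primrec.and.to_comp.comp hp hq).of_eq fun x => by simp

theorem computable_decide_or {p q : β → Prop} [DecidablePred p] [DecidablePred q]
    (hp : Computable fun x => decide (p x)) (hq : Computable fun x => decide (q x)) :
    Computable fun x => decide (p x ∨ q x) :=
  (Primrec.or.to_comp.comp hp hq).of_eq fun x => by simp

theorem computable_decide_eq {γ : Type} [Primcodable γ] [DecidableEq γ] {f g : β → γ}
    (hf : Computable f) (hg : Computable g) : Computable fun x => decide (f x = g x) :=
  (Primrec.eq.decide.to_comp.comp hf hg).of_eq fun x => by simp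

theorem computable_pair {f g : β → ℕ} (hf : Computable f) (hg : Computable g) :
    Computable fun x => Nat.pair (f x) (g x) :=
  Primrec₂.natPair.to_comp.comp hf hg

theorem computable_unpair_fst {f : β → ℕ} (hf : Computable f) :
    Computable fun x => (f x).unpair.1 :=
  (Primrec.fst.comp Primrec.unpair).to_comp.comp hf

theorem computable_unpair_snd {f : β → ℕ} (hf : Computable f) :
    Computable fun x => (f x).unpair.2 :=
  (Primrec.snd.comp Primrec.unpair).to_comp.comp hf

theorem computable_add_one {f : β → ℕ} (hf : Computable f) : Computable fun x => f x + 1 :=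
  Computable.succ.comp hf

theorem computable_flagAddr {f : β → ℕ} (hf : Computable f) : Computable fun x => flagAddr (f x) :=
  computable_add_one (computable_pair (Computable.const 0) hf)

theorem computable_tableAddr {f g : β → ℕ} (hf : Computable f) (hg : Computable g) :
    Computable fun x => tableAddr (f x) (g x) :=
  computable_add_one (computable_pair (computable_add_one hf) hg)

end Computability

theorem computable_altItem (l : ℕ) : Computable (altItem l) := by
  have hx : Computable fun v : AltState => v.2.1 := Computable.fst.comp Computable.snd
  have hk : Computable fun v : AltState => v.2.2.1 :=
    Computable.fst.comp (Computable.snd.comp Computable.snd)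
  have hq : Computable fun v : AltState => v.2.2.2 :=
    Computable.snd.comp (Computable.snd.comp Computable.snd)
  exact computable_ite (computable_decide_eq hk (Computable.const l))
    (computable_pair (computable_pair hx (computable_unpair_fst hq)) (computable_unpair_snd hq)) hq

/-- The control unit that computes, in its stages `0, …, l - 1`, the tables of `Alternation a k` for
`k = 1, …, l`, and in its stage `l` searches for a `z` with `¬ Alternation a l ⟨⟨x, y⟩, z⟩` for
`y = 0, 1, …`, showing the output `true` whenever it finds one. -/
def altController (a : ℕ → Bool) (ha : Computable a) (l : ℕ) : Controller AltState :=
  have hr : Computable fun w : AltState × Bool => w.1.1 := Computable.fst.comp Computable.fst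
  have hb : Computable fun w : AltState × Bool => w.2 := Computable.snd
  have hx : Computable fun w : AltState × Bool => w.1.2.1 :=
    Computable.fst.comp (Computable.snd.comp Computable.fst)
  have hk : Computable fun w : AltState × Bool => w.1.2.2.1 :=
    Computable.fst.comp (Computable.snd.comp (Computable.snd.comp Computable.fst))
  have hq : Computable fun w : AltState × Bool => w.1.2.2.2 :=
    Computable.snd.comp (Computable.snd.comp (Computable.snd.comp Computable.fst))
  have hrt := computable_decide_eq hr (Computable.const true)
  have hkl := computable_decide_eq hk (Computable.const l)
  have hval : Computable (altValue a l) :=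
    computable_ite
      (computable_decide_and hrt (computable_decide_eq hk (Computable.const 0)))
      (ha.comp ((computable_altItem l).comp Computable.fst)) hb
  have hvt := computable_decide_eq hval (Computable.const true)
  have hni : Computable (altNextItem a l) :=
    computable_ite hkl
      (computable_ite hvt
        (computable_pair (computable_unpair_fst hq) (computable_add_one (computable_unpair_snd hq)))
        (computable_pair (computable_add_one (computable_unpair_fst hq)) (Computable.const 0)))
      (computable_add_one hq)
  { start := fun x => (false, x, 0, 0)
    readAddr := altReadAddr l
    writeAddr := altWriteAddr a l
    writeBit := fun w => !altValue a l w
    next := altNext a l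
    computable_start := (Computable.const false).pair (Computable.id.pair (Computable.const (0, 0)))
    computable_readAddr :=
      computable_ite (computable_decide_eq Computable.fst (Computable.const true))
        (computable_tableAddr (Computable.fst.comp (Computable.snd.comp Computable.snd))
          (computable_altItem l))
        (computable_flagAddr (Computable.fst.comp (Computable.snd.comp Computable.snd)))
    computable_writeAddr :=
      computable_ite (computable_decide_or hvt (computable_decide_and hrt hkl))
        (Computable.const 0)
        (computable_ite hrt
          (computable_tableAddr (computable_add_one hk) (computable_unpair_fst hq))
          (computable_flagAddr hk))
    computable_writeBit := Primrec.not.to_comp.comp hval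
    computable_next :=
      computable_ite hrt ((Computable.const true).pair (hx.pair (hk.pair hni)))
        (computable_ite (computable_decide_eq hb (Computable.const true))
          ((Computable.const false).pair
            (hx.pair ((computable_add_one hk).pair (Computable.const 0))))
          ((Computable.const true).pair (hx.pair (hk.pair (Computable.const 0))))) }

theorem flagAddr_inj {i j : ℕ} : flagAddr i = flagAddr j ↔ i = j := by
  simp [flagAddr]

theorem tableAddr_inj {k i k' i' : ℕ} : tableAddr k i = tableAddr k' i' ↔ k = k' ∧ i = i' := by
  simp [tableAddr]

theorem flagAddr_ne_tableAddr (j k i : ℕ) : flagAddr j ≠ tableAddr k i := by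
  simp [tableAddr, flagAddr]

/-- What the memory holds in the stage `k` when `f` stages have set their flags and the items below
`q` have been dealt with in this stage. -/
def TablesUpTo (a : ℕ → Bool) (k f q : ℕ) (m : ℕ → Bool) : Prop :=
  (∀ j, m (flagAddr j) = true ↔ j < f) ∧
  ∀ j i, m (tableAddr j i) = true ↔ (1 ≤ j ∧ j ≤ k ∧ Alternation a j i) ∨
    (j = k + 1 ∧ ∃ t < q, t.unpair.1 = i ∧ ¬ Alternation a k t)

section Correctness

variable {a : ℕ → Bool} (ha : Computable a) {l : ℕ} {x : ℕ} {s : Controller.Store} {k : ℕ}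

/-- The flags tell the control unit in which stage it is. -/
theorem altController_conf_detect (h : TablesUpTo a k k 0 s.mem) :
    ∀ j ≤ k, ∃ o, (altController a ha l).conf x s j = ((false, x, j, 0), ⟨s.mem, o⟩) := by
  intro j
  induction j with
  | zero => exact fun _ => ⟨s.out, rfl⟩
  | succ j ih =>
    intro hj
    obtain ⟨o, ho⟩ := ih (by omega)
    have hb : s.mem (flagAddr j) = true := (h.1 j).2 (by omega)
    rw [Controller.conf_succ, ho]
    simp [Controller.step, altController, altReadAddr, hb, altNext, altWriteAddr, altValue,
      Controller.Store.write]

/-- When the control unit has found out the number of the stage it sets the flag of this stage. -/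
theorem altController_conf_mark (h : TablesUpTo a k k 0 s.mem) :
    ∃ c, (altController a ha l).conf x s (k + 1) = ((true, x, k, 0), c) ∧
      TablesUpTo a k (k + 1) 0 c.mem := by
  obtain ⟨o, ho⟩ := altController_conf_detect ha (l := l) (x := x) h k le_rfl
  have hb : s.mem (flagAddr k) = false := by
    rw [Bool.eq_false_iff, Ne, h.1 k]
    omega
  refine ⟨⟨Function.update s.mem (flagAddr k) true, o⟩, ?_, ?_⟩
  · rw [Controller.conf_succ, ho]
    simp [Controller.step, altController, altReadAddr, hb, altNext, altWriteAddr, altValue,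
      Controller.Store.write]
    simp [flagAddr]
  · refine ⟨fun j => ?_, fun j i => ?_⟩
    · rcases eq_or_ne j k with rfl | hjk
      · simp
      · dsimp only
        rw [Function.update_of_ne (by rwa [Ne, flagAddr_inj]), h.1 j]
        omega
    · dsimp only
      rw [Function.update_of_ne (flagAddr_ne_tableAddr _ _ _).symm, h.2]

theorem altValue_eq_true_iff {q f r : ℕ} {m : ℕ → Bool} (h : TablesUpTo a k f q m) :
    altValue a l ((true, x, k, r), m (altReadAddr l (true, x, k, r))) = true ↔
      Alternation a k (altItem l (true, x, k, r)) := by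
  rcases Nat.eq_zero_or_pos k with rfl | hk
  · simp [altValue, Alternation]
  · simp only [altValue, altReadAddr, hk.ne', and_false, if_false, if_true, h.2]
    simp [Nat.succ_le_iff.2 hk]

/-- The progress of a stage before the last one. -/
theorem altController_conf_table (hkl : k < l) (h : TablesUpTo a k k 0 s.mem) (q : ℕ) :
    ∃ c, (altController a ha l).conf x s (k + 1 + q) = ((true, x, k, q), c) ∧
      TablesUpTo a k (k + 1) q c.mem := by
  induction q with
  | zero => exact altController_conf_mark ha h
  | succ q ih =>
    obtain ⟨c, hc, ht⟩ := ih
    have hv := altValue_eq_true_iff (l := l) (x := x) (r := q) ht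
    have hitem : altItem l (true, x, k, q) = q := by simp [altItem, hkl.ne]
    rw [hitem] at hv
    rw [← Nat.add_assoc, Controller.conf_succ, hc]
    refine ⟨_, Prod.ext ?_ rfl, ?_⟩
    · simp [Controller.step, altController, altNext, altNextItem, hkl.ne]
    · set b := c.mem (altReadAddr l (true, x, k, q)) with hb
      change TablesUpTo a k (k + 1) (q + 1) (c.write (altWriteAddr a l ((true, x, k, q), b))
        (!altValue a l ((true, x, k, q), b))).mem
      by_cases hq : Alternation a k q
      · have hvt := hv.2 hq
        refine ⟨?_, fun j i => ?_⟩
        · simpa [altWriteAddr, hvt, Controller.Store.write] using ht.1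
        · have hstep : (∃ t < q + 1, t.unpair.1 = i ∧ ¬ Alternation a k t) ↔
              ∃ t < q, t.unpair.1 = i ∧ ¬ Alternation a k t := by
            constructor
            · rintro ⟨t, h1, h2, h3⟩
              refine ⟨t, ?_, h2, h3⟩
              have : t ≠ q := by rintro rfl; exact h3 hq
              omega
            · rintro ⟨t, h1, h2⟩
              exact ⟨t, by omega, h2⟩
          rw [hstep]
          simpa [altWriteAddr, hvt, Controller.Store.write] using ht.2 j i
      · have hvf : altValue a l ((true, x, k, q), b) = false := by
          rw [Bool.eq_false_iff]
          exact fun h => hq (hv.1 h)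
        have haddr : altWriteAddr a l ((true, x, k, q), b) = tableAddr (k + 1) q.unpair.1 := by
          simp [altWriteAddr, hvf, hkl.ne]
        have hw : c.write (altWriteAddr a l ((true, x, k, q), b))
            (!altValue a l ((true, x, k, q), b)) =
              ⟨Function.update c.mem (tableAddr (k + 1) q.unpair.1) true, c.out⟩ := by
          rw [haddr, hvf, Controller.Store.write, if_neg (by simp [tableAddr])]
          rfl
        rw [hw]
        refine ⟨fun j => ?_, fun j i => ?_⟩ <;> dsimp only
        · rw [Function.update_of_ne (flagAddr_ne_tableAddr _ _ _), ht.1]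
        · by_cases hji : j = k + 1 ∧ i = q.unpair.1
          · obtain ⟨rfl, rfl⟩ := hji
            rw [Function.update_self]
            simp only [true_iff]
            exact Or.inr ⟨trivial, q, by omega, rfl, hq⟩
          · rw [Function.update_of_ne (by rwa [Ne, tableAddr_inj]), ht.2]
            refine or_congr Iff.rfl (and_congr_right fun hj => ⟨?_, ?_⟩)
            · rintro ⟨t, h1, h2⟩
              exact ⟨t, by omega, h2⟩
            · rintro ⟨t, h1, h2, h3⟩
              refine ⟨t, ?_, h2, h3⟩
              have : t ≠ q := by rintro rfl; exact hji ⟨hj, h2.symm⟩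
              omega

/-- A stage before the last one adds one more table. -/
theorem altController_limit_table (hkl : k < l) (h : TablesUpTo a k k 0 s.mem) :
    TablesUpTo a (k + 1) (k + 1) 0 ((altController a ha l).limit x s).mem := by
  have hconf : ∀ j, k + 1 ≤ j →
      TablesUpTo a k (k + 1) (j - (k + 1)) ((altController a ha l).conf x s j).2.mem := by
    intro j hj
    obtain ⟨c, hc, ht⟩ := altController_conf_table ha (x := x) hkl h (j - (k + 1))
    rw [Nat.add_sub_cancel' hj] at hc
    rw [hc]
    exact ht
  refine ⟨fun j => ?_, fun j i => ?_⟩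
  · by_cases hj : j < k + 1
    · simp only [hj, iff_true]
      exact boolLimsup_eq_of_eventually (k + 1) fun t ht => ((hconf t ht).1 j).2 hj
    · simp only [hj, iff_false, Bool.not_eq_true]
      refine boolLimsup_eq_of_eventually (k + 1) fun t ht => ?_
      rw [Bool.eq_false_iff]
      exact fun h => hj (((hconf t ht).1 j).1 h)
  · simp only [not_lt_zero, false_and, exists_false, and_false, or_false]
    rw [Controller.limit, boolLimsup_eq_true]
    constructor
    · intro hN
      obtain ⟨t, ht, hm⟩ := hN (k + 1)
      rcases ((hconf t ht).2 j i).1 hm with ⟨h1, h2, h3⟩ | ⟨rfl, z, -, rfl, h3⟩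
      · exact ⟨h1, by omega, h3⟩
      · refine ⟨by omega, le_rfl, z.unpair.2, ?_⟩
        rwa [Nat.pair_unpair]
    · rintro ⟨h1, h2, h3⟩ N
      rcases Nat.lt_or_eq_of_le h2 with h2 | rfl
      · exact ⟨max N (k + 1), le_max_left _ _,
          ((hconf _ (le_max_right _ _)).2 j i).2 (Or.inl ⟨h1, by omega, h3⟩)⟩
      · obtain ⟨z, hz⟩ := h3
        refine ⟨N + (k + 1) + (Nat.pair i z + 1), by omega, ((hconf _ (by omega)).2 _ i).2 ?_⟩
        exact Or.inr ⟨rfl, Nat.pair i z, by omega, by simp, hz⟩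

/-- In the last stage the tables do not change any more. -/
theorem altController_conf_search (h : TablesUpTo a l l 0 s.mem) (j : ℕ) :
    ∃ q c, (altController a ha l).conf x s (l + 1 + j) = ((true, x, l, q), c) ∧
      TablesUpTo a l (l + 1) 0 c.mem := by
  induction j with
  | zero =>
    obtain ⟨c, hc⟩ := altController_conf_mark ha (l := l) (x := x) h
    exact ⟨0, c, hc⟩
  | succ j ih =>
    obtain ⟨q, c, hc, ht⟩ := ih
    rw [← Nat.add_assoc, Controller.conf_succ, hc]
    refine ⟨altNextItem a l ((true, x, l, q), c.mem (altReadAddr l (true, x, l, q))), _,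
      Prod.ext ?_ rfl, ?_⟩
    · simp [Controller.step, altController, altNext]
    · simpa [Controller.step, altController, altWriteAddr, Controller.Store.write] using ht

/-- The last stage adds the two outermost quantifiers. -/
theorem altController_limit_search (h : TablesUpTo a l l 0 s.mem) :
    ((altController a ha l).limit x s).out = true ↔
      ∀ y, ∃ z, ¬ Alternation a l (Nat.pair (Nat.pair x y) z) := by
  choose q c hc ht using altController_conf_search ha (x := x) h
  have hv : ∀ j, altValue a l ((true, x, l, q j), (c j).mem (altReadAddr l (true, x, l, q j))) = true
      ↔ Alternation a l (Nat.pair (Nat.pair x (q j).unpair.1) (q j).unpair.2) := by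
    intro j
    rw [altValue_eq_true_iff (ht j), altItem, if_pos rfl]
  have hq : ∀ j, q (j + 1) =
      altNextItem a l ((true, x, l, q j), (c j).mem (altReadAddr l (true, x, l, q j))) := by
    intro j
    have h1 := hc (j + 1)
    rw [← Nat.add_assoc, Controller.conf_succ, hc j] at h1
    have h2 := congrArg (fun z => z.1.2.2.2) h1
    simp only [Controller.step, altController, altNext, if_true] at h2
    exact h2.symm
  have hout : ∀ j, (c (j + 1)).out = true ↔
      ¬ Alternation a l (Nat.pair (Nat.pair x (q j).unpair.1) (q j).unpair.2) := by
    intro j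
    have h1 := hc (j + 1)
    rw [← Nat.add_assoc, Controller.conf_succ, hc j] at h1
    have h2 := congrArg (fun z => z.2.out) h1
    simp only [Controller.step, altController, altWriteAddr, Controller.Store.write] at h2
    simp only [and_self, or_true, if_true] at h2
    rw [← h2, ← hv j]
    simp
  have hq0 : q 0 = 0 := by
    obtain ⟨c', hc'⟩ := altController_conf_mark ha (l := l) (x := x) h
    have h1 := (hc 0).symm.trans hc'.1
    exact congrArg (fun z => z.1.2.2.2) h1
  rw [← frequently_search_iff (p := fun j => (q j).unpair)]
  · rw [Controller.limit, boolLimsup_eq_true]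
    constructor
    · intro hN N
      obtain ⟨j, hj, hjo⟩ := hN (l + 1 + (N + 1))
      obtain ⟨i, rfl⟩ := Nat.exists_eq_add_of_le hj
      refine ⟨N + i, by omega, (hout (N + i)).1 ?_⟩
      have h1 := hc (N + i + 1)
      rw [show l + 1 + (N + i + 1) = l + 1 + (N + 1) + i by omega] at h1
      rwa [h1] at hjo
    · intro hN N
      obtain ⟨j, hj, hjo⟩ := hN N
      refine ⟨l + 1 + (j + 1), by omega, ?_⟩
      rw [hc (j + 1)]
      exact (hout j).2 hjo
  · simp only [hq0, Nat.unpair_zero]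
    rfl
  · intro j hj
    have : altValue a l ((true, x, l, q j), (c j).mem (altReadAddr l (true, x, l, q j))) = false :=
      Bool.eq_false_iff.2 fun h => hj ((hv j).1 h)
    simp [hq j, altNextItem, this]
  · intro j hj
    have := (hv j).2 (not_not.1 hj)
    simp [hq j, altNextItem, this]

/-- The store at the beginning of the stage `k`. -/
theorem altController_stage (hkl : k ≤ l) :
    TablesUpTo a k k 0 ((altController a ha l).stage x k).mem := by
  induction k with
  | zero =>
    refine ⟨fun j => by simp [Controller.stage], fun j i => ?_⟩
    simp only [Controller.stage, Bool.false_eq_true, not_lt_zero, false_and, exists_false,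
      and_false, or_false, false_iff]
    omega
  | succ k ih => exact altController_limit_table ha hkl (ih (by omega))

theorem altController_stage_out :
    ((altController a ha l).stage x (l + 1)).out = true ↔
      ∀ y, ∃ z, ¬ Alternation a l (Nat.pair (Nat.pair x y) z) :=
  altController_limit_search ha (altController_stage ha le_rfl)

end Correctness

end ArithmeticalHierarchy

/-! ### Runs with an invariant -/

/-- The element `b` is reached from `a` by iterating `f` at least once, and `Q` holds all along. -/
def Reach {C : Type*} (f : C → C) (Q : C → Prop) : C → C → Prop :=
  Relation.TransGen fun a b => f a = b ∧ Q a ∧ Q b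

theorem Reach.trans {C : Type*} {f : C → C} {Q : C → Prop} {a b c : C} (h : Reach f Q a b)
    (h' : Reach f Q b c) : Reach f Q a c :=
  Relation.TransGen.trans h h'

theorem Reach.exists_iterate {C : Type*} {f : C → C} {Q : C → Prop} {a b : C}
    (h : Reach f Q a b) : ∃ n, 0 < n ∧ f^[n] a = b ∧ ∀ i ≤ n, Q (f^[i] a) := by
  induction h with
  | single h =>
    obtain ⟨rfl, ha, hb⟩ := h
    refine ⟨1, one_pos, rfl, fun i hi => ?_⟩
    interval_cases i
    · exact ha
    · exact hb
  | tail _ h ih =>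
    obtain ⟨n, hn, rfl, hQ⟩ := ih
    obtain ⟨rfl, ha, hb⟩ := h
    refine ⟨n + 1, n.succ_pos, Function.iterate_succ_apply' _ _ _, fun i hi => ?_⟩
    rcases Nat.le_succ_iff.1 hi with hi | rfl
    · exact hQ i hi
    · rwa [Function.iterate_succ_apply']

/-! ### A while language with unary registers and a bit memory -/

namespace RegisterMachine

/-- The data of a register machine apart from its registers: a bit memory with an output bit, and an
input device that can be asked whether there is one more unit of the input `inp`. It says yes `inp`
times in turn and then no once, and so on; `rem` units remain in the current turn. -/
@[ext]
structure Data where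
  store : Controller.Store
  rem : ℕ
  inp : ℕ

/-- The tests: whether a register is not `0`, whether the memory bit whose address is in a register
is set, and whether there is one more unit of input. -/
inductive Test
  | nonzero (r : ℕ)
  | bit (r : ℕ)
  | take

/-- The result of a test, together with the data after it. -/
def Test.eval (ρ : ℕ → ℕ) (d : Data) : Test → Bool × Data
  | nonzero r => (decide (ρ r ≠ 0), d)
  | bit r => (d.store.mem (ρ r), d)
  | take => if d.rem = 0 then (false, { d with rem := d.inp }) else
      (true, { d with rem := d.rem - 1 })

/-- The instructions of a register machine with labels in `L`. An instruction `boot` clears all the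
registers. -/
inductive Instr (L : Type)
  | inc (r : ℕ) (l : L)
  | dec (r : ℕ) (l : L)
  | write (r : ℕ) (b : Bool) (l : L)
  | out (b : Bool) (l : L)
  | test (t : Test) (l₁ l₂ : L)
  | boot (l : L)

/-- A configuration: the current label, the contents of the registers, and the data. -/
abbrev Conf (L : Type) := L × (ℕ → ℕ) × Data

/-- The effect of one instruction. -/
def Instr.exec {L : Type} (ρ : ℕ → ℕ) (d : Data) : Instr L → Conf L
  | inc r l => (l, Function.update ρ r (ρ r + 1), d)
  | dec r l => (l, Function.update ρ r (ρ r - 1), d)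
  | write r b l =>
      (l, ρ, { d with store := { d.store with mem := Function.update d.store.mem (ρ r) b } })
  | out b l => (l, ρ, { d with store := { d.store with out := b } })
  | test t l₁ l₂ => (if (t.eval ρ d).1 = true then l₁ else l₂, ρ, (t.eval ρ d).2)
  | boot l => (l, fun _ => 0, d)

/-- One step of the register machine with the code `C`. -/
def step {L : Type} (C : L → Instr L) (c : Conf L) : Conf L :=
  (C c.1).exec c.2.1 c.2.2

/-- Structured programs. -/
inductive Prog
  | inc (r : ℕ)
  | dec (r : ℕ)
  | write (r : ℕ) (b : Bool)
  | out (b : Bool)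
  | seq (p q : Prog)
  | ite (t : Test) (p q : Prog)
  | while (t : Test) (p : Prog)

namespace Prog

/-- The labels that are used in the compilation of a program. -/
def Label : Prog → Type
  | inc _ | dec _ | write _ _ | out _ => Unit
  | seq p q => p.Label ⊕ q.Label
  | ite _ p q => Option (p.Label ⊕ q.Label)
  | .while _ p => Option p.Label

instance finite_label : ∀ p : Prog, Finite p.Label
  | inc _ | dec _ | write _ _ | out _ => inferInstanceAs (Finite Unit)
  | seq p q =>
    have := finite_label p
    have := finite_label q
    inferInstanceAs (Finite (p.Label ⊕ q.Label))
  | ite _ p q =>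
    have := finite_label p
    have := finite_label q
    inferInstanceAs (Finite (Option (p.Label ⊕ q.Label)))
  | .while _ p =>
    have := finite_label p
    inferInstanceAs (Finite (Option p.Label))

/-- The label at which a program is entered. -/
def entry : (p : Prog) → p.Label
  | inc _ | dec _ | write _ _ | out _ => ()
  | seq p _ => Sum.inl p.entry
  | ite _ _ _ => none
  | .while _ _ => none

/-- The code of a program, where `ι` embeds its labels into those of the whole machine and `e` is
the label to which the machine goes on leaving the program. -/
def code {L : Type} : (p : Prog) → (p.Label → L) → L → p.Label → Instr L
  | inc r, _, e => fun _ => .inc r e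
  | dec r, _, e => fun _ => .dec r e
  | write r b, _, e => fun _ => .write r b e
  | out b, _, e => fun _ => .out b e
  | seq p q, ι, e => fun l =>
    Sum.elim (p.code (ι ∘ Sum.inl) (ι (Sum.inr q.entry))) (q.code (ι ∘ Sum.inr) e) l
  | ite t p q, ι, e => fun l =>
    Option.elim l
      (.test t (ι (some (Sum.inl p.entry))) (ι (some (Sum.inr q.entry))))
      (Sum.elim (p.code (ι ∘ some ∘ Sum.inl) e) (q.code (ι ∘ some ∘ Sum.inr) e))
  | .while t p, ι, e => fun l =>
    Option.elim l (.test t (ι (some p.entry)) e) (p.code (ι ∘ some) (ι none))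

end Prog

/-- A bound for the registers that occur in a test. -/
def Test.bound : Test → ℕ
  | nonzero r | bit r => r + 1
  | take => 0

/-- A bound for the registers that occur in an instruction. -/
def Instr.bound {L : Type} : Instr L → ℕ
  | inc r _ | dec r _ | write r _ _ => r + 1
  | out _ _ | boot _ => 0
  | test t _ _ => t.bound

namespace Prog

/-- A bound for the registers that occur in a program. -/
def bound : Prog → ℕ
  | inc r | dec r | write r _ => r + 1
  | out _ => 0
  | seq p q => max p.bound q.bound
  | ite t p q => max t.bound (max p.bound q.bound)
  | .while t p => max t.bound p.bound

theorem bound_code_le {L : Type} : ∀ (p : Prog) (ι : p.Label → L) (e : L) (l : p.Label),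
    (p.code ι e l).bound ≤ p.bound
  | inc _, _, _, _ | dec _, _, _, _ | write _ _, _, _, _ | out _, _, _, _ => le_rfl
  | seq p _, _, _, Sum.inl l => (bound_code_le p _ _ l).trans (le_max_left _ _)
  | seq _ q, _, _, Sum.inr l => (bound_code_le q _ _ l).trans (le_max_right _ _)
  | ite _ _ _, _, _, none => le_max_left _ _
  | ite _ p _, _, _, some (Sum.inl l) =>
    (bound_code_le p _ _ l).trans ((le_max_left _ _).trans (le_max_right _ _))
  | ite _ _ q, _, _, some (Sum.inr l) =>
    (bound_code_le q _ _ l).trans ((le_max_right _ _).trans (le_max_right _ _))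
  | .while _ _, _, _, none => le_max_left _ _
  | .while _ p, _, _, some l => (bound_code_le p _ _ l).trans (le_max_right _ _)

/-- The program `p` leads from the registers `ρ` and the data `d` to the registers `ρ'` and the data
`d'`, and the data satisfy `Q` all along. -/
def Runs (Q : Data → Prop) (p : Prog) (ρ : ℕ → ℕ) (d : Data) (ρ' : ℕ → ℕ) (d' : Data) : Prop :=
  ∀ ⦃L : Type⦄ (C : L → Instr L) (ι : p.Label → L) (e : L), (∀ l, C (ι l) = p.code ι e l) →
    Reach (step C) (fun c => Q c.2.2) (ι p.entry, ρ, d) (e, ρ', d')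

section Rules

variable {Q : Data → Prop} {p q : Prog} {t : Test} {ρ ρ₁ ρ' : ℕ → ℕ} {d d₁ d₂ d' : Data}

theorem runs_inc (r : ℕ) (h : Q d) : Runs Q (inc r) ρ d (Function.update ρ r (ρ r + 1)) d :=
  fun _ C ι e hC => .single ⟨by rw [step, hC (entry (inc r))]; rfl, h, h⟩

theorem runs_dec (r : ℕ) (h : Q d) : Runs Q (dec r) ρ d (Function.update ρ r (ρ r - 1)) d :=
  fun _ C ι e hC => .single ⟨by rw [step, hC (entry (dec r))]; rfl, h, h⟩

theorem runs_write (r : ℕ) (b : Bool) (h : Q d)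
    (h' : Q { d with store := { d.store with mem := Function.update d.store.mem (ρ r) b } }) :
    Runs Q (write r b) ρ d ρ
      { d with store := { d.store with mem := Function.update d.store.mem (ρ r) b } } :=
  fun _ C ι e hC => .single ⟨by rw [step, hC (entry (write r b))]; rfl, h, h'⟩

theorem runs_out (b : Bool) (h : Q d) (h' : Q { d with store := { d.store with out := b } }) :
    Runs Q (out b) ρ d ρ { d with store := { d.store with out := b } } :=
  fun _ C ι e hC => .single ⟨by rw [step, hC (entry (out b))]; rfl, h, h'⟩

theorem Runs.seq (hp : Runs Q p ρ d ρ₁ d₁) (hq : Runs Q q ρ₁ d₁ ρ' d') :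
    Runs Q (seq p q) ρ d ρ' d' :=
  fun _ C ι e hC => (hp C (ι ∘ Sum.inl) _ fun l => hC (Sum.inl l)).trans
    (hq C (ι ∘ Sum.inr) e fun l => hC (Sum.inr l))

theorem Runs.ite_true (ht : t.eval ρ d = (true, d₁)) (h : Q d) (h₁ : Q d₁)
    (hp : Runs Q p ρ d₁ ρ' d') : Runs Q (ite t p q) ρ d ρ' d' := by
  intro L C ι e hC
  refine Reach.trans (.single ⟨?_, h, h₁⟩) (hp C (ι ∘ some ∘ Sum.inl) e fun l => hC (some (.inl l)))
  rw [step, hC (entry (ite t p q))]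
  simp [entry, code, Instr.exec, ht]
  rfl

theorem Runs.ite_false (ht : t.eval ρ d = (false, d₁)) (h : Q d) (h₁ : Q d₁)
    (hq : Runs Q q ρ d₁ ρ' d') : Runs Q (ite t p q) ρ d ρ' d' := by
  intro L C ι e hC
  refine Reach.trans (.single ⟨?_, h, h₁⟩) (hq C (ι ∘ some ∘ Sum.inr) e fun l => hC (some (.inr l)))
  rw [step, hC (entry (ite t p q))]
  simp [entry, code, Instr.exec, ht]
  rfl

theorem runs_while_false (ht : t.eval ρ d = (false, d₁)) (h : Q d) (h₁ : Q d₁) :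
    Runs Q (.while t p) ρ d ρ d₁ := by
  intro L C ι e hC
  refine .single ⟨?_, h, h₁⟩
  rw [step, hC (entry (.while t p))]
  simp [entry, code, Instr.exec, ht]

theorem Runs.while_true (ht : t.eval ρ d = (true, d₁)) (h : Q d) (h₁ : Q d₁)
    (hp : Runs Q p ρ d₁ ρ₁ d₂) (hw : Runs Q (.while t p) ρ₁ d₂ ρ' d') :
    Runs Q (.while t p) ρ d ρ' d' := by
  intro L C ι e hC
  refine Reach.trans (.single ⟨?_, h, h₁⟩)
    (Reach.trans (hp C (ι ∘ some) (ι none) fun l => hC (some l)) (hw C ι e hC))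
  rw [step, hC (entry (.while t p))]
  simp [entry, code, Instr.exec, ht]
  rfl

end Rules

/-! ### Programs for the partial recursive functions -/

/-- The program `p` leads from the registers `ρ` to the registers `ρ'` without touching the data. -/
def PureRuns (p : Prog) (ρ ρ' : ℕ → ℕ) : Prop :=
  ∀ (Q : Data → Prop) (d : Data), Q d → Runs Q p ρ d ρ' d

theorem pureRuns_inc (ρ : ℕ → ℕ) (r : ℕ) : PureRuns (inc r) ρ (Function.update ρ r (ρ r + 1)) :=
  fun _ _ h => runs_inc r h

theorem pureRuns_dec (ρ : ℕ → ℕ) (r : ℕ) : PureRuns (dec r) ρ (Function.update ρ r (ρ r - 1)) :=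
  fun _ _ h => runs_dec r h

theorem PureRuns.seq {p q : Prog} {ρ ρ₁ ρ' : ℕ → ℕ} (hp : PureRuns p ρ ρ₁)
    (hq : PureRuns q ρ₁ ρ') : PureRuns (seq p q) ρ ρ' :=
  fun Q d h => Runs.seq (hp Q d h) (hq Q d h)

/-- A loop that is run through `n` times, with the registers `σ k` after `k` times. -/
theorem pureRuns_while {p : Prog} {r : ℕ} (n : ℕ) (σ : ℕ → ℕ → ℕ)
    (h : ∀ k < n, σ k r ≠ 0 ∧ PureRuns p (σ k) (σ (k + 1))) (hn : σ n r = 0) :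
    PureRuns (.while (.nonzero r) p) (σ 0) (σ n) := by
  intro Q d hd
  induction n generalizing σ with
  | zero => exact runs_while_false (by simp [Test.eval, hn]) hd hd
  | succ n ih =>
    obtain ⟨h1, h2⟩ := h 0 n.succ_pos
    exact Runs.while_true (by simp [Test.eval, h1]) hd hd (h2 Q d hd)
      (ih (fun k => σ (k + 1)) (fun k hk => h (k + 1) (by omega)) hn)

/-- Set the register `r` to `0`. -/
def clear (r : ℕ) : Prog := .while (.nonzero r) (dec r)

theorem pureRuns_clear (ρ : ℕ → ℕ) (r : ℕ) : PureRuns (clear r) ρ (Function.update ρ r 0) := by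
  have := pureRuns_while (p := dec r) (r := r) (ρ r) (fun k => Function.update ρ r (ρ r - k))
    (fun k hk => ⟨by simp; omega, ?_⟩) (by simp)
  · simpa [clear] using this
  · have := pureRuns_dec (Function.update ρ r (ρ r - k)) r
    simpa [Nat.sub_sub] using this

/-- Add the register `a` to the register `b` and set `a` to `0`. -/
def move (a b : ℕ) : Prog := .while (.nonzero a) (seq (dec a) (inc b))

theorem pureRuns_move (ρ : ℕ → ℕ) {a b : ℕ} (hab : a ≠ b) :
    PureRuns (move a b) ρ (Function.update (Function.update ρ a 0) b (ρ b + ρ a)) := by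
  have := pureRuns_while (p := seq (dec a) (inc b)) (r := a) (ρ a)
    (fun k => Function.update (Function.update ρ a (ρ a - k)) b (ρ b + k))
    (fun k hk => ⟨by simp [hab]; omega, ?_⟩) (by simp [hab])
  · simpa [move] using this
  · convert (pureRuns_dec _ a).seq (pureRuns_inc _ b) using 1
    funext i
    simp only [Function.update_apply]
    grind

/-- Add the register `a` to the register `b`, by means of the register `c`. -/
def copy (a b c : ℕ) : Prog :=
  seq (move a c) (.while (.nonzero c) (seq (dec c) (seq (inc a) (inc b))))

theorem pureRuns_copy (ρ : ℕ → ℕ) {a b c : ℕ} (hab : a ≠ b) (hac : a ≠ c) (hbc : b ≠ c)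
    (hc : ρ c = 0) : PureRuns (copy a b c) ρ (Function.update ρ b (ρ b + ρ a)) := by
  refine (pureRuns_move ρ hac).seq ?_
  have := pureRuns_while (p := seq (dec c) (seq (inc a) (inc b))) (r := c) (ρ a)
    (fun k => Function.update (Function.update (Function.update ρ a k) c (ρ a - k)) b (ρ b + k))
    (fun k hk => ⟨by simp [hbc.symm]; omega, ?_⟩) (by simp [hbc.symm])
  · convert this using 1 <;> funext i <;> simp only [Function.update_apply] <;> grind
  · convert (pureRuns_dec _ c).seq ((pureRuns_inc _ a).seq (pureRuns_inc _ b)) using 1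
    funext i
    simp only [Function.update_apply]
    grind

/-- The function `f` can be computed by programs: for any choice of registers for the arguments and
for the value, there is a program that writes the value into its register, provided that this
register and all the registers from some number on are `0`; in the end these are `0` again. -/
def Implements {n : ℕ} (f : List.Vector ℕ n →. ℕ) : Prop :=
  ∀ (ins : Fin n → ℕ) (dst N : ℕ), (∀ i, ins i < N) → dst < N → (∀ i, ins i ≠ dst) →
    ∃ p : Prog, ∀ (ρ : ℕ → ℕ) (a : ℕ), (∀ r, N ≤ r → ρ r = 0) → ρ dst = 0 →
      a ∈ f (List.Vector.ofFn fun i => ρ (ins i)) → PureRuns p ρ (Function.update ρ dst a)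

theorem implements_zero : Implements (n := 0) fun _ => Part.some 0 := by
  refine fun ins dst N _ _ _ => ⟨clear dst, fun ρ a _ _ ha => ?_⟩
  rw [Part.mem_some_iff] at ha
  exact ha ▸ pureRuns_clear ρ dst

theorem implements_get {n : ℕ} (i : Fin n) : Implements fun v => Part.some (v.get i) := by
  refine fun ins dst N hi hd hne => ⟨copy (ins i) dst N, fun ρ a hN h0 ha => ?_⟩
  rw [Part.mem_some_iff, List.Vector.get_ofFn] at ha
  have := pureRuns_copy ρ (hne i) (hi i).ne hd.ne (hN N le_rfl)
  rwa [h0, zero_add, ← ha] at this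

theorem implements_succ : Implements (n := 1) fun v => Part.some (v.head + 1) := by
  refine fun ins dst N hi hd hne => ⟨seq (copy (ins 0) dst N) (inc dst), fun ρ a hN h0 ha => ?_⟩
  rw [Part.mem_some_iff, List.Vector.head_ofFn] at ha
  have := (pureRuns_copy ρ (hne 0) (hi 0).ne hd.ne (hN N le_rfl)).seq (pureRuns_inc _ dst)
  simpa [h0, ha] using this

/-- The values of several functions are computed one after the other. -/
theorem exists_prog_tuple {n m : ℕ} {g : Fin n → List.Vector ℕ m →. ℕ}
    (hg : ∀ i, Implements (g i)) (ins : Fin m → ℕ) (N : ℕ) (hi : ∀ i, ins i < N) (k : ℕ)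
    (hk : k ≤ n) :
    ∃ p : Prog, ∀ (ρ w : ℕ → ℕ), (∀ r, N ≤ r → ρ r = 0) →
      (∀ i : Fin n, w i ∈ g i (List.Vector.ofFn fun i => ρ (ins i))) →
      PureRuns p ρ fun r => if N ≤ r ∧ r < N + k then w (r - N) else ρ r := by
  induction k with
  | zero =>
    refine ⟨clear N, fun ρ w hN _ => ?_⟩
    convert pureRuns_clear ρ N using 1
    funext r
    simp only [Function.update_apply]
    grind
  | succ k ih =>
    obtain ⟨p, hp⟩ := ih (by omega)
    obtain ⟨q, hq⟩ := hg ⟨k, hk⟩ ins (N + k) (N + n) (fun i => by have := hi i; omega) (by omega)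
      (fun i => by have := hi i; omega)
    refine ⟨seq p q, fun ρ w hN hw => (hp ρ w hN hw).seq ?_⟩
    convert hq _ (w k) ?_ ?_ ?_ using 1
    · funext r
      simp only [Function.update_apply]
      grind
    · intro r hr
      rw [if_neg (by omega)]
      exact hN r (by omega)
    · rw [if_neg (by omega)]
      exact hN _ (by omega)
    · convert hw ⟨k, hk⟩ using 3
      funext i
      have := hi i
      rw [if_neg (by omega)]

theorem exists_prog_clear (N k : ℕ) :
    ∃ p : Prog, ∀ ρ : ℕ → ℕ, PureRuns p ρ fun r => if N ≤ r ∧ r ≤ N + k then 0 else ρ r := by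
  induction k with
  | zero =>
    refine ⟨clear N, fun ρ => ?_⟩
    convert pureRuns_clear ρ N using 1
    funext r
    simp only [Function.update_apply]
    grind
  | succ k ih =>
    obtain ⟨p, hp⟩ := ih
    refine ⟨seq p (clear (N + (k + 1))), fun ρ => ?_⟩
    convert (hp ρ).seq (pureRuns_clear _ _) using 1
    funext r
    simp only [Function.update_apply]
    grind

theorem Implements.comp {n m : ℕ} {f : List.Vector ℕ n →. ℕ} {g : Fin n → List.Vector ℕ m →. ℕ}
    {h : List.Vector ℕ m →. ℕ} (hf : Implements f) (hg : ∀ i, Implements (g i))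
    (hh : ∀ v a, a ∈ h v → ∃ w : ℕ → ℕ, (∀ i : Fin n, w i ∈ g i v) ∧
      a ∈ f (List.Vector.ofFn fun i => w i)) : Implements h := by
  intro ins dst N hi hd hne
  obtain ⟨p, hp⟩ := exists_prog_tuple hg ins N hi n le_rfl
  obtain ⟨q, hq⟩ := hf (fun i => N + i) dst (N + n) (fun i => by omega) (by omega)
    (fun i => by omega)
  obtain ⟨c, hc⟩ := exists_prog_clear N n
  refine ⟨seq p (seq q c), fun ρ a hN h0 ha => ?_⟩
  obtain ⟨w, hw, ha⟩ := hh _ _ ha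
  refine (hp ρ w hN hw).seq ((hq _ a ?_ ?_ ?_).seq ?_)
  · intro r hr
    rw [if_neg (by omega)]
    exact hN r (by omega)
  · rw [if_neg (by omega), h0]
  · simpa using ha
  · convert hc _ using 1
    funext r
    simp only [Function.update_apply]
    grind

theorem Implements.prec {n : ℕ} {f : List.Vector ℕ n → ℕ} {g : List.Vector ℕ (n + 2) → ℕ}
    (hf : Implements fun v => Part.some (f v)) (hg : Implements fun v => Part.some (g v)) :
    Implements fun v : List.Vector ℕ (n + 1) =>
      Part.some (v.head.rec (f v.tail) fun y IH => g (y ::ᵥ IH ::ᵥ v.tail)) := by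
  intro ins dst N hi hd hne
  obtain ⟨p, hp⟩ := hf (fun i => ins i.succ) (N + 2) (N + 4)
    (fun i => by have := hi i.succ; omega) (by omega) (fun i => by have := hi i.succ; omega)
  obtain ⟨q, hq⟩ := hg (Fin.cons (N + 1) (Fin.cons (N + 2) fun i => ins i.succ)) (N + 3) (N + 4)
    (fun i => by
      refine Fin.cases (by simp) (fun i => Fin.cases (by simp) (fun i => ?_) i) i
      have := hi i.succ
      simp only [Fin.cons_succ]
      omega)
    (by omega)
    (fun i => by
      refine Fin.cases (by simp) (fun i => Fin.cases (by simp) (fun i => ?_) i) i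
      have := hi i.succ
      simp only [Fin.cons_succ]
      omega)
  -- The registers `N`, `N + 1`, `N + 2` hold the number of iterations that remain, the number of
  -- those that have been made, and the value that has been reached.
  refine ⟨seq (copy (ins 0) N (N + 3)) (seq p (seq
    (.while (.nonzero N) (seq (dec N) (seq q (seq (clear (N + 2)) (seq (move (N + 3) (N + 2))
      (inc (N + 1)))))))
    (seq (move (N + 2) dst) (clear (N + 1))))), fun ρ a hN h0 ha => ?_⟩
  rw [Part.mem_some_iff, List.Vector.head_ofFn, List.Vector.tail_ofFn] at ha
  set v : List.Vector ℕ n := List.Vector.ofFn fun i => ρ (ins i.succ) with hv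
  obtain ⟨F, hF0, hFs, hFa⟩ : ∃ F : ℕ → ℕ, F 0 = f v ∧ (∀ k, F (k + 1) = g (k ::ᵥ F k ::ᵥ v)) ∧
      a = F (ρ (ins 0)) :=
    ⟨fun k => Nat.rec (f v) (fun y IH => g (y ::ᵥ IH ::ᵥ v)) k, rfl, fun _ => rfl, ha⟩
  have hi0 := hi 0
  have hN0 := hN N le_rfl
  have hN1 := hN (N + 1) (by omega)
  have hN2 := hN (N + 2) (by omega)
  have hN3 := hN (N + 3) (by omega)
  set σ : ℕ → ℕ → ℕ := fun k => Function.update (Function.update (Function.update ρ N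
    (ρ (ins 0) - k)) (N + 1) k) (N + 2) (F k) with hσ
  have hσin : ∀ k (i : Fin n), σ k (ins i.succ) = ρ (ins i.succ) := by
    intro k i
    have := hi i.succ
    simp only [hσ, Function.update_apply]
    grind
  have hσN : ∀ k r, N + 3 ≤ r → σ k r = 0 := by
    intro k r hr
    have := hN r (by omega)
    simp only [hσ, Function.update_apply]
    grind
  refine (pureRuns_copy ρ (a := ins 0) (b := N) (c := N + 3) (by omega) (by omega) (by omega)
    hN3).seq (PureRuns.seq (ρ₁ := σ 0) ?_ (PureRuns.seq (ρ₁ := σ (ρ (ins 0))) ?_ ?_))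
  · convert hp _ (f v) ?_ ?_ ?_ using 1
    · funext r
      simp only [hσ, hF0, Function.update_apply]
      grind
    · intro r hr
      rw [Function.update_of_ne (by omega)]
      exact hN r (by omega)
    · rw [Function.update_of_ne (by omega)]
      exact hN2
    · rw [Part.mem_some_iff, hv]
      congr 2
      funext i
      have := hi i.succ
      rw [Function.update_of_ne (by omega)]
  · refine pureRuns_while _ σ (fun k hk => ⟨?_, ?_⟩) ?_
    · simp only [hσ, Function.update_apply]
      grind
    · refine (pureRuns_dec _ N).seq (PureRuns.seq (hq _ (F (k + 1)) ?_ ?_ ?_)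
        ((pureRuns_clear _ _).seq ?_))
      · intro r hr
        rw [Function.update_of_ne (by omega)]
        exact hσN k r (by omega)
      · rw [Function.update_of_ne (by omega)]
        exact hσN k _ le_rfl
      · rw [Part.mem_some_iff]
        rw [hFs]
        congr 1
        rw [List.Vector.ofFn, List.Vector.ofFn]
        congr 1
        · simp [hσ]
        · congr 1
          · simp [hσ]
          · rw [hv]
            congr 1
            funext i
            have := hi i.succ
            simp only [Fin.cons_succ]
            rw [Function.update_of_ne (by omega), hσin]
      · convert (pureRuns_move _ (a := N + 3) (b := N + 2) (by omega)).seq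
          (pureRuns_inc _ (N + 1)) using 1
        have h3 := hσN k (N + 3) le_rfl
        funext r
        simp only [hσ, Function.update_apply] at h3 ⊢
        grind
    · simp only [hσ, Function.update_apply]
      grind
  · convert (pureRuns_move _ (a := N + 2) (b := dst) (by omega)).seq
      (pureRuns_clear _ (N + 1)) using 1
    rw [hFa]
    funext r
    simp only [hσ, Function.update_apply]
    grind

theorem Implements.rfind {n : ℕ} {f : List.Vector ℕ (n + 1) → ℕ}
    (hf : Implements fun v => Part.some (f v)) :
    Implements fun v : List.Vector ℕ n =>
      Nat.rfind fun k => Part.some (decide (f (k ::ᵥ v) = 0)) := by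
  intro ins dst N hi hd hne
  obtain ⟨p, hp⟩ := hf (Fin.cons dst ins) N (N + 1)
    (fun i => by
      refine Fin.cases (by simp; omega) (fun i => ?_) i
      have := hi i
      simp only [Fin.cons_succ]
      omega)
    (by omega)
    (fun i => by
      refine Fin.cases (by simp; omega) (fun i => ?_) i
      have := hi i
      simp only [Fin.cons_succ]
      omega)
  -- The candidates are counted in the register `dst` itself.
  refine ⟨seq p (.while (.nonzero N) (seq (clear N) (seq (inc dst) p))), fun ρ a hN h0 ha => ?_⟩
  set v : List.Vector ℕ n := List.Vector.ofFn fun i => ρ (ins i) with hv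
  obtain ⟨ha, hlt⟩ := Nat.mem_rfind.1 ha
  simp only [Part.mem_some_iff] at ha hlt
  set σ : ℕ → ℕ → ℕ := fun k => Function.update (Function.update ρ dst k) N (f (k ::ᵥ v)) with hσ
  have hN0 := hN N le_rfl
  have hstep : ∀ k, PureRuns p (Function.update ρ dst k) (σ k) := by
    intro k
    refine hp _ _ ?_ ?_ ?_
    · intro r hr
      rw [Function.update_of_ne (by omega)]
      exact hN r (by omega)
    · rw [Function.update_of_ne (by omega), hN0]
    · rw [Part.mem_some_iff]
      congr 1
      rw [List.Vector.ofFn]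
      congr 1
      · simp
      · rw [hv]
        congr 1
        funext i
        simp [hne i]
  have hrun := pureRuns_while (p := seq (clear N) (seq (inc dst) p)) (r := N) a σ
    (fun k hk => ⟨?_, ?_⟩) ?_
  · refine PureRuns.seq (ρ₁ := σ 0) ?_ ?_
    · have := hstep 0
      rwa [← h0, Function.update_eq_self, h0] at this
    · convert hrun using 1
      have : f (a ::ᵥ v) = 0 := by simpa using ha.symm
      funext r
      simp only [hσ, Function.update_apply]
      grind
  · have := hlt hk
    simpa [hσ] using this
  · refine (pureRuns_clear _ N).seq ((pureRuns_inc _ dst).seq ?_)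
    convert hstep (k + 1) using 1
    funext r
    simp only [hσ, Function.update_apply]
    grind
  · simpa [hσ] using ha.symm

theorem implements_of_primrec' {n : ℕ} {f : List.Vector ℕ n → ℕ} (hf : Nat.Primrec' f) :
    Implements fun v => Part.some (f v) := by
  induction hf with
  | zero => exact implements_zero
  | succ => exact implements_succ
  | get i => exact implements_get i
  | @comp m n f g _ _ ihf ihg =>
    refine ihf.comp ihg fun v a ha => ⟨fun i => if h : i < n then g ⟨i, h⟩ v else 0, ?_, ?_⟩
    · simp
    · simpa using ha
  | prec _ _ ihf ihg => exact ihf.prec ihg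

theorem get_mem_of_mem_mOfFn {n : ℕ} {g : Fin n → Part ℕ} {v : List.Vector ℕ n}
    (h : v ∈ List.Vector.mOfFn g) : ∀ i, v.get i ∈ g i := by
  induction n with
  | zero => exact fun i => i.elim0
  | succ n ih =>
    simp only [List.Vector.mOfFn, Part.bind_eq_bind, Part.mem_bind_iff, Part.pure_eq_some,
      Part.mem_some_iff] at h
    obtain ⟨a, ha, w, hw, rfl⟩ := h
    refine Fin.cases (by simpa using ha) fun i => ?_
    simpa using ih hw i

theorem implements_of_partrec' {n : ℕ} {f : List.Vector ℕ n →. ℕ} (hf : Nat.Partrec' f) :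
    Implements f := by
  induction hf with
  | prim hf => exact implements_of_primrec' hf
  | @comp m n f g _ _ ihf ihg =>
    refine ihf.comp ihg fun v a ha => ?_
    obtain ⟨w, hw, ha⟩ := Part.mem_bind_iff.1 ha
    refine ⟨fun i => if h : i < n then w.get ⟨i, h⟩ else 0, fun i => ?_, ?_⟩
    · simpa using get_mem_of_mem_mOfFn hw i
    · simpa using ha
  | rfind _ ih => exact ih.rfind

/-- A computable function of one argument is computed by a program. -/
theorem exists_prog_of_computable {φ : ℕ → ℕ} (hφ : Computable φ) {src dst N : ℕ} (hs : src < N)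
    (hd : dst < N) (hne : src ≠ dst) :
    ∃ p : Prog, ∀ ρ : ℕ → ℕ, (∀ r, N ≤ r → ρ r = 0) → ρ dst = 0 →
      PureRuns p ρ (Function.update ρ dst (φ (ρ src))) := by
  have h : Implements (n := 1) fun v => Part.some (φ v.head) :=
    implements_of_partrec' (Nat.Partrec'.part_iff₁.2 hφ)
  obtain ⟨p, hp⟩ := h (fun _ => src) dst N (fun _ => hs) hd (fun _ => hne)
  exact ⟨p, fun ρ hN h0 => hp ρ _ hN h0 (by simp)⟩

end Prog

end RegisterMachine

/-! ### Programs for control units -/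

namespace RegisterMachine

open Encodable

/-- A computable function acts on codes as a computable function of natural numbers. -/
theorem exists_computable_on_codes {α β : Type} [Primcodable α] [Primcodable β] {f : α → β}
    (hf : Computable f) : ∃ φ : ℕ → ℕ, Computable φ ∧ ∀ a, φ (encode a) = encode (f a) := by
  have h : Computable₂ fun (_ : ℕ) (y : α) => encode (f y) :=
    (Computable.encode.comp (hf.comp Computable.snd)).to₂
  exact ⟨_, Computable.option_casesOn Computable.decode (Computable.const 0) h, fun x => by simp⟩

/-- The registers that hold `v` in the register `0` and are `0` otherwise. -/
def single (v : ℕ) : ℕ → ℕ := Function.update (fun _ => 0) 0 v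

open Prog

/-- The input is copied into the register `0`, after which the input device is in its original
state. -/
theorem runs_take (s : Controller.Store) (n k : ℕ) :
    Runs (fun _ => True) (.while .take (inc 0)) (single k) ⟨s, n, k + n⟩ (single (k + n))
      ⟨s, k + n, k + n⟩ := by
  induction n generalizing k with
  | zero => exact runs_while_false rfl trivial trivial
  | succ n ih =>
    refine Runs.while_true (d₁ := ⟨s, n, k + (n + 1)⟩) rfl trivial trivial (runs_inc 0 trivial) ?_
    have := ih (k + 1)
    rw [show k + 1 + n = k + (n + 1) by omega] at this
    convert this using 1
    funext i
    simp [single]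

/-- The program that is executed at the beginning of each stage: it copies the input into a register
and computes the initial control state. The argument `x` is represented by `x + 1` units of input,
so that a request for input always changes the number of the remaining units, and is thus visible in
the data. -/
theorem exists_prog_start {α : Type} [Primcodable α] (D : Controller α) :
    ∃ p : Prog, ∀ (x : ℕ) (s : Controller.Store),
      Runs (fun _ => True) p (fun _ => 0) ⟨s, x + 1, x + 1⟩ (single (encode (D.start x)))
        ⟨s, x + 1, x + 1⟩ := by
  have hφ : Computable fun n : ℕ => encode (D.start (n - 1)) :=
    Computable.encode.comp (D.computable_start.comp Computable.pred)
  obtain ⟨p, hp⟩ := exists_prog_of_computable hφ (src := 0) (dst := 1) (N := 2)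
    two_pos one_lt_two zero_ne_one
  refine ⟨seq (.while .take (inc 0)) (seq p (seq (clear 0) (move 1 0))), fun x s => ?_⟩
  have h0 := runs_take s (x + 1) 0
  rw [Nat.zero_add] at h0
  have hz : single 0 = fun _ => 0 := by simp [single]
  rw [hz] at h0
  refine h0.seq ?_
  refine PureRuns.seq (hp _ ?_ ?_) ((pureRuns_clear _ 0).seq ?_) _ _ trivial
  · intro r hr
    exact Function.update_of_ne (by omega) _ _
  · exact Function.update_of_ne one_ne_zero _ _
  · convert pureRuns_move _ one_ne_zero using 1
    funext i
    simp only [single, Function.update_apply]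
    grind

/-- The program that executes one step of a control unit. The data jump from their old value to the
new one without any value in between. -/
theorem exists_prog_step {α : Type} [Primcodable α] (D : Controller α) :
    ∃ p : Prog, ∀ (n : ℕ) (c : α × Controller.Store),
      Runs (fun d => d = ⟨c.2, n, n⟩ ∨ d = ⟨(D.step c).2, n, n⟩) p
        (single (encode c.1)) ⟨c.2, n, n⟩ (single (encode (D.step c).1)) ⟨(D.step c).2, n, n⟩ := by
  obtain ⟨ra, hra, era⟩ := exists_computable_on_codes D.computable_readAddr
  obtain ⟨wa, hwa, ewa⟩ := exists_computable_on_codes D.computable_writeAddr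
  obtain ⟨wb, hwb, ewb⟩ := exists_computable_on_codes D.computable_writeBit
  obtain ⟨nx, hnx, enx⟩ := exists_computable_on_codes D.computable_next
  have hpr : ∀ b : Bool, Computable fun v : ℕ => Nat.pair v (encode b) := fun b =>
    Primrec₂.natPair.to_comp.comp Computable.id (Computable.const _)
  obtain ⟨p₁, hp₁⟩ := exists_prog_of_computable hra (src := 0) (dst := 1) (N := 3)
    (by omega) (by omega) (by omega)
  have h₂ := fun b => exists_prog_of_computable (hpr b) (src := 0) (dst := 2) (N := 3)
    (by omega) (by omega) (by omega)
  choose p₂ hp₂ using h₂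
  obtain ⟨p₃, hp₃⟩ := exists_prog_of_computable hwa (src := 2) (dst := 1) (N := 3)
    (by omega) (by omega) (by omega)
  obtain ⟨p₄, hp₄⟩ := exists_prog_of_computable hwb (src := 2) (dst := 0) (N := 3)
    (by omega) (by omega) (by omega)
  obtain ⟨p₅, hp₅⟩ := exists_prog_of_computable hnx (src := 2) (dst := 0) (N := 3)
    (by omega) (by omega) (by omega)
  -- The control state is in the register `0`, addresses are in the register `1`, and the control state
  -- together with the bit that has been read is in the register `2`.
  refine ⟨seq p₁ (seq (ite (.bit 1) (p₂ true) (p₂ false)) (seq (seq (clear 0) (seq (clear 1)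
    (seq p₃ p₄))) (seq (ite (.nonzero 1) (ite (.nonzero 0) (write 1 true) (write 1 false))
      (ite (.nonzero 0) (out true) (out false)))
    (seq (clear 1) (seq (clear 0) (seq p₅ (clear 2))))))), ?_⟩
  rintro n ⟨v, s⟩
  set d : Data := ⟨s, n, n⟩ with hd
  set b := s.mem (D.readAddr v) with hb
  set d' : Data := ⟨s.write (D.writeAddr (v, b)) (D.writeBit (v, b)), n, n⟩ with hd'
  have hstep : D.step (v, s) =
    (D.next (v, b), s.write (D.writeAddr (v, b)) (D.writeBit (v, b))) := rfl
  rw [hstep]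
  obtain ⟨Q, hQd⟩ : ∃ Q : Data → Prop, Q = fun e => e = d ∨ e = d' := ⟨_, rfl⟩
  have hQ : Q d := by rw [hQd]; exact Or.inl rfl
  have hQ' : Q d' := by rw [hQd]; exact Or.inr rfl
  suffices h : Runs Q _ (single (encode v)) d (single (encode (D.next (v, b)))) d' by
    rw [hQd] at h
    exact h
  clear hQd
  set w := encode (v, b) with hw
  -- the registers after each part of the program
  set ρ₁ : ℕ → ℕ := fun r => if r = 0 then encode v else if r = 1 then D.readAddr v else 0 with h1
  set ρ₂ : ℕ → ℕ := Function.update ρ₁ 2 w with h2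
  set ρ₃ : ℕ → ℕ := fun r => if r = 0 then encode (D.writeBit (v, b)) else
    if r = 1 then D.writeAddr (v, b) else if r = 2 then w else 0 with h3
  refine Runs.seq (ρ₁ := ρ₁) (d₁ := d) ?_ (Runs.seq (ρ₁ := ρ₂) (d₁ := d) ?_
    (Runs.seq (ρ₁ := ρ₃) (d₁ := d) ?_ (Runs.seq (ρ₁ := ρ₃) (d₁ := d') ?_ ?_)))
  · have := hp₁ (single (encode v)) (fun r hr => Function.update_of_ne (by omega) _ _)
      (Function.update_of_ne one_ne_zero _ _) Q d hQ
    convert this using 1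
    have : ra (single (encode v) 0) = D.readAddr v := by simpa [single] using era v
    rw [this]
    funext r
    simp only [h1, single, Function.update_apply]
    grind
  · have hrun := fun b => hp₂ b ρ₁ (fun r hr => by
      simp only [h1]
      rw [if_neg (by omega), if_neg (by omega)]) (by simp [h1]) Q d hQ
    have hev : Test.eval ρ₁ d (.bit 1) = (b, d) := rfl
    cases hbv : b with
    | true =>
      refine Runs.ite_true (hev.trans (by rw [hbv])) hQ hQ ?_
      convert hrun true using 1
      rw [h2, hw, hbv]
      rfl
    | false =>
      refine Runs.ite_false (hev.trans (by rw [hbv])) hQ hQ ?_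
      convert hrun false using 1
      rw [h2, hw, hbv]
      rfl
  · refine PureRuns.seq (pureRuns_clear _ 0) ((pureRuns_clear _ 1).seq
      (PureRuns.seq (hp₃ _ ?_ ?_) ?_)) _ d hQ
    · intro r hr
      simp only [h2, h1, Function.update_apply]
      grind
    · simp
    · convert hp₄ _ ?_ ?_ using 1
      · have e1 := ewa (v, b)
        have e2 := ewb (v, b)
        rw [← hw] at e1 e2
        rw [encode_nat] at e1
        have e3 : ρ₂ 2 = w := by simp [h2]
        simp [e3, e1, e2]
        funext r
        simp only [h3, h2, h1, Function.update_apply]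
        grind
      · intro r hr
        simp only [h2, h1, Function.update_apply]
        grind
      · simp
  · have ht : ∀ e, Test.eval ρ₃ e (.nonzero 0) = (D.writeBit (v, b), e) := by
      intro e
      simp only [Test.eval, h3, if_true]
      cases D.writeBit (v, b) <;> rfl
    have hr1 : ρ₃ 1 = D.writeAddr (v, b) := by simp [h3]
    by_cases hz : D.writeAddr (v, b) = 0
    · have hd'' : d' = { d with store := { d.store with out := D.writeBit (v, b) } } := by
        rw [hd', Controller.Store.write, if_pos hz]
      refine Runs.ite_false (by simp [Test.eval, hr1, hz]) hQ hQ ?_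
      rw [hd''] at hQ' ⊢
      cases hu : D.writeBit (v, b) with
      | true =>
        rw [hu] at hQ'
        exact Runs.ite_true (by rw [ht, hu]) hQ hQ (runs_out true hQ hQ')
      | false =>
        rw [hu] at hQ'
        exact Runs.ite_false (by rw [ht, hu]) hQ hQ (runs_out false hQ hQ')
    · have hd'' : d' = { d with store := { d.store with
          mem := Function.update d.store.mem (ρ₃ 1) (D.writeBit (v, b)) } } := by
        rw [hd', Controller.Store.write, if_neg hz, hr1]
      refine Runs.ite_true (by simp [Test.eval, hr1, hz]) hQ hQ ?_
      rw [hd''] at hQ' ⊢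
      cases hu : D.writeBit (v, b) with
      | true =>
        rw [hu] at hQ'
        exact Runs.ite_true (by rw [ht, hu]) hQ hQ (runs_write 1 true hQ hQ')
      | false =>
        rw [hu] at hQ'
        exact Runs.ite_false (by rw [ht, hu]) hQ hQ (runs_write 1 false hQ hQ')
  · refine PureRuns.seq (pureRuns_clear _ 1) ((pureRuns_clear _ 0).seq
      (PureRuns.seq (hp₅ _ ?_ ?_) ?_)) _ d' hQ'
    · intro r hr
      simp only [h3, Function.update_apply]
      grind
    · simp
    · convert pureRuns_clear _ 2 using 1
      have e1 := enx (v, b)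
      rw [← hw] at e1
      have e3 : ρ₃ 2 = w := by simp [h3]
      simp [e3, e1]
      funext r
      simp only [h3, single, Function.update_apply]
      grind

end RegisterMachine

/-! ### A Turing machine that simulates a register machine -/

namespace TapeMachine

open RegisterMachine

/-- The phases of the simulation. In the phase `home` the machine goes to the square with the number
`home` and begins with the next instruction there. The phases `seek`, `second` and `back` belong to
the instructions that work to the right of that square. In the other ones the machine is to the left
of it, or sets up the tape. -/
inductive Phase
  | start | startFirst | startSkip | startLast | startEnd | startGap | startHome
  | home | seek | second | back
  | left | leftOnes | leftEnd | takeCheck | takeOne | takeNone | fill | fillEnd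
  | right | rightGap | rightOnes | rightZeros | rightEnd

instance : Finite Phase := by
  classical
  exact @Finite.of_fintype _ (Fintype.ofList [.start, .startFirst, .startSkip, .startLast, .startEnd,
    .startGap, .startHome, .home, .seek, .second, .back, .left, .leftOnes, .leftEnd, .takeCheck,
    .takeOne, .takeNone, .fill, .fillEnd, .right, .rightGap, .rightOnes, .rightZeros, .rightEnd]
    fun p => by cases p <;> simp)

/-- The states: a phase, a label of the register machine, and the track on which the head is. To the
left of the home square there are no tracks, and the last component is `0`. -/
abbrev State (L : Type) (R : ℕ) := Phase × L × ZMod (R + 2)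

variable {L : Type}

section Machine

variable (C : L → Instr L) (R : ℕ)

/-- The move in the first phase to the right of the home square. -/
def seekMove (l : L) (t : ZMod (R + 2)) (s : Bool) : Bool × Turing.Dir × State L R :=
  match C l with
  | .inc r _ =>
    if t = ((r + 1 : ℕ) : ZMod (R + 2)) ∧ s = false then (true, .right, (.second, l, t + 1))
    else (s, .right, (.seek, l, t + 1))
  | .dec r l' =>
    if t = ((r + 1 : ℕ) : ZMod (R + 2)) then
      if s = true then (s, .right, (.second, l, t + 1)) else (s, .left, (.home, l', t - 1))
    else (s, .right, (.seek, l, t + 1))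
  | .write r _ _ | .test (.bit r) _ _ =>
    if t = ((r + 1 : ℕ) : ZMod (R + 2)) ∧ s = false then (s, .right, (.second, l, t + 1))
    else (s, .right, (.seek, l, t + 1))
  | .test (.nonzero r) l₁ l₂ =>
    if t = ((r + 1 : ℕ) : ZMod (R + 2)) then
      (s, .left, (.home, if s = true then l₁ else l₂, t - 1))
    else (s, .right, (.seek, l, t + 1))
  | .boot l' =>
    if t = ((R + 1 : ℕ) : ZMod (R + 2)) then (s, .left, (.home, l', t - 1))
    else (false, .right, (.seek, l, t + 1))
  | _ => (s, .right, (.seek, l, t + 1))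

/-- The move in the second phase to the right of the home square. -/
def secondMove (l : L) (t : ZMod (R + 2)) (s : Bool) : Bool × Turing.Dir × State L R :=
  match C l with
  | .inc r l' =>
    if t = ((r + 1 : ℕ) : ZMod (R + 2)) then (false, .left, (.home, l', t - 1))
    else (s, .right, (.second, l, t + 1))
  | .dec r _ =>
    if t = ((r + 1 : ℕ) : ZMod (R + 2)) ∧ s = false then (s, .left, (.back, l, t - 1))
    else (s, .right, (.second, l, t + 1))
  | .write _ b l' =>
    if t = ((R + 1 : ℕ) : ZMod (R + 2)) then (b, .left, (.home, l', t - 1))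
    else (s, .right, (.second, l, t + 1))
  | .test (.bit _) l₁ l₂ =>
    if t = ((R + 1 : ℕ) : ZMod (R + 2)) then
      (s, .left, (.home, if s = true then l₁ else l₂, t - 1))
    else (s, .right, (.second, l, t + 1))
  | _ => (s, .right, (.second, l, t + 1))

/-- The move in the third phase to the right of the home square. -/
def backMove (l : L) (t : ZMod (R + 2)) (s : Bool) : Bool × Turing.Dir × State L R :=
  match C l with
  | .dec r l' =>
    if t = ((r + 1 : ℕ) : ZMod (R + 2)) then (false, .left, (.home, l', t - 1))
    else (s, .left, (.back, l, t - 1))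
  | _ => (s, .left, (.back, l, t - 1))

/-- The beginning of an instruction, on the home square. -/
def dispatch (l : L) : Turing.Dir × State L R :=
  match C l with
  | .out _ _ | .test .take _ _ => (.left, (.left, l, 0))
  | _ => (.right, (.seek, l, 1))

/-- The phase in which the machine meets the ones to the left of the home square. -/
def onesPhase (l : L) : Phase :=
  match C l with
  | .out _ _ => .leftOnes
  | _ => .takeCheck

/-- The bit that an instruction writes into the first square. -/
def outBit (l : L) : Bool :=
  match C l with
  | .out b _ => b
  | _ => false

/-- The label that follows after an output, or after a successful request for input. -/
def nextLabel (l : L) : L :=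
  match C l with
  | .out _ l' => l'
  | .test _ l₁ _ => l₁
  | _ => l

/-- The label that follows after an unsuccessful request for input. -/
def elseLabel (l : L) : L :=
  match C l with
  | .test _ _ l₂ => l₂
  | _ => l

/-- The transition function. -/
def delta : State L R → Bool → Bool × Turing.Dir × State L R
  | (.start, l, _), s => (s, .right, (.startFirst, l, 0))
  | (.startFirst, l, _), s => (false, .right, (if s = true then .startSkip else .startLast, l, 0))
  | (.startSkip, l, _), s =>
    if s = true then (s, .right, (.startSkip, l, 0)) else (true, .right, (.startLast, l, 0))
  | (.startLast, l, _), _ => (true, .right, (.startEnd, l, 0))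
  | (.startEnd, l, _), _ => (true, .right, (.startGap, l, 0))
  | (.startGap, l, _), s => (s, .right, (.startHome, l, 0))
  | (.startHome, l, _), _ => (true, .left, (.rightEnd, l, 0))
  | (.home, l, t), s =>
    if t = 0 ∧ s = true then (s, dispatch C R l) else (s, .left, (.home, l, t - 1))
  | (.seek, l, t), s => seekMove C R l t s
  | (.second, l, t), s => secondMove C R l t s
  | (.back, l, t), s => backMove C R l t s
  | (.left, l, _), s =>
    if s = true then (s, .left, (onesPhase C l, l, 0)) else (s, .left, (.left, l, 0))
  | (.leftOnes, l, _), s =>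
    if s = true then (s, .left, (.leftOnes, l, 0)) else (s, .left, (.leftEnd, l, 0))
  | (.leftEnd, l, _), _ => (outBit C l, .right, (.rightGap, nextLabel C l, 0))
  | (.takeCheck, l, _), s =>
    if s = true then (s, .right, (.takeOne, l, 0)) else (s, .right, (.takeNone, l, 0))
  | (.takeOne, l, _), _ => (false, .right, (.rightZeros, nextLabel C l, 0))
  | (.takeNone, l, _), s => (s, .right, (.fill, l, 0))
  | (.fill, l, _), s =>
    if s = true then (s, .left, (.fillEnd, l, 0)) else (true, .right, (.fill, l, 0))
  | (.fillEnd, l, _), _ => (false, .right, (.home, elseLabel C l, 0))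
  | (.right, l, _), s => (s, .right, (.rightGap, l, 0))
  | (.rightGap, l, _), s => (s, .right, (.rightOnes, l, 0))
  | (.rightOnes, l, _), s =>
    if s = true then (s, .right, (.rightOnes, l, 0)) else (s, .right, (.rightZeros, l, 0))
  | (.rightZeros, l, _), s =>
    if s = true then (s, .left, (.rightEnd, l, 0)) else (s, .right, (.rightZeros, l, 0))
  | (.rightEnd, l, _), s => (s, .right, (.home, l, 0))

/-- The infinite time Turing machine that simulates the register machine with the code `C`. The
register machine is started at the label `l₀` initially and at each limit time. -/
def machine [Finite L] (l₀ : L) : InfiniteTimeTM where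
  State := State L R
  finite_state := inferInstance
  initState := (.start, l₀, 0)
  limitState := (.right, l₀, 0)
  instr q s := some (delta C R q s)

/-- One step of the machine, which never halts. -/
def tapeStep [Finite L] (l₀ : L) (c : (machine C R l₀).Config) : (machine C R l₀).Config :=
  let a := delta C R c.state (c.tape c.head)
  { state := a.2.2
    head := InfiniteTimeTM.moveHead a.2.1 c.head
    tape := Function.update c.tape c.head a.1 }

theorem step_machine [Finite L] (l₀ : L) (c : (machine C R l₀).Config) :
    (machine C R l₀).step c = some (tapeStep C R l₀ c) := rfl

end Machine

/-- The number of the home square, to the left of which there is room for `n` units of input. -/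
def homeSquare (n : ℕ) : ℕ := n + 4

/-- From the home square on, the tape is divided into blocks of length `R + 2`. This is the number of
the square on the track `t` in the block `j`. -/
def square (R n j t : ℕ) : ℕ := homeSquare n + ((R + 2) * j + t)

/-- The data are represented on a tape: the first square holds the output bit, the second one is
empty, then come `d.rem + 1` ones, and then zeros up to the home square. The track `0` marks the home
square, and the last track holds the memory. -/
structure Represents (R : ℕ) (d : Data) (τ : ℕ → Bool) : Prop where
  out : τ 0 = d.store.out
  gap : τ 1 = false
  ones : ∀ i ≤ d.rem, τ (2 + i) = true
  zeros : ∀ i, d.rem < i → i ≤ d.inp + 1 → τ (2 + i) = false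
  home : τ (homeSquare d.inp) = true
  marks : ∀ j, 1 ≤ j → τ (square R d.inp j 0) = false
  mem : ∀ j, τ (square R d.inp j (R + 1)) = d.store.mem j

/-- The registers are represented on a tape: the content of the register `r` is the number of the
first block in which there is a `0` on the track `r + 1`. Whatever comes after that is disregarded,
because after a limit time the tape is full of garbage. -/
def RepresentsReg (R n : ℕ) (ρ : ℕ → ℕ) (τ : ℕ → Bool) : Prop :=
  ∀ r < R, (∀ j < ρ r, τ (square R n j (r + 1)) = true) ∧ τ (square R n (ρ r) (r + 1)) = false

theorem cast_eq_cast_iff {R i t : ℕ} (ht : t < R + 2) :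
    (i : ZMod (R + 2)) = (t : ZMod (R + 2)) ↔ i % (R + 2) = t := by
  rw [ZMod.natCast_eq_natCast_iff', Nat.mod_eq_of_lt ht]

theorem mul_add_mod_of_lt {R j t : ℕ} (ht : t < R + 2) : ((R + 2) * j + t) % (R + 2) = t := by
  rw [Nat.mul_add_mod, Nat.mod_eq_of_lt ht]

theorem cast_mul_add (R j t : ℕ) : (((R + 2) * j + t : ℕ) : ZMod (R + 2)) = (t : ZMod (R + 2)) := by
  rw [ZMod.natCast_eq_natCast_iff', Nat.mul_add_mod]

theorem square_inj {R n j t j' t' : ℕ} (ht : t < R + 2) (ht' : t' < R + 2) :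
    square R n j t = square R n j' t' ↔ j = j' ∧ t = t' := by
  constructor
  · intro h
    have h' : (R + 2) * j + t = (R + 2) * j' + t' := by
      unfold square at h
      omega
    have h1 := congrArg (· % (R + 2)) h'
    simp only [mul_add_mod_of_lt ht, mul_add_mod_of_lt ht'] at h1
    subst h1
    exact ⟨Nat.eq_of_mul_eq_mul_left (by omega) (Nat.add_right_cancel h'), rfl⟩
  · rintro ⟨rfl, rfl⟩
    rfl

theorem homeSquare_eq (R n : ℕ) : homeSquare n = square R n 0 0 := rfl

theorem ne_square_of_lt {R n i : ℕ} (h : i < homeSquare n) (j t : ℕ) : i ≠ square R n j t := by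
  unfold square
  omega

theorem Represents.update_reg {R : ℕ} {d : Data} {τ : ℕ → Bool} (h : Represents R d τ)
    (hd : d.rem ≤ d.inp) {j t : ℕ} (ht : 1 ≤ t) (htR : t ≤ R) (b : Bool) :
    Represents R d (Function.update τ (square R d.inp j t) b) := by
  have hlt : ∀ i, i < d.inp + 4 → i ≠ square R d.inp j t := fun i hi => ne_square_of_lt hi j t
  have hne : ∀ j' t', t' < R + 2 → t' ≠ t → square R d.inp j' t' ≠ square R d.inp j t := by
    intro j' t' h1 h2 h3
    exact h2 ((square_inj h1 (by omega)).1 h3).2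
  refine ⟨?_, ?_, fun i hi => ?_, fun i hi hi' => ?_, ?_, fun j' hj' => ?_, fun j' => ?_⟩
  · rw [Function.update_of_ne (hlt 0 (by omega)), h.out]
  · rw [Function.update_of_ne (hlt 1 (by omega)), h.gap]
  · rw [Function.update_of_ne (hlt _ (by omega)), h.ones i hi]
  · rw [Function.update_of_ne (hlt _ (by omega)), h.zeros i hi hi']
  · rw [homeSquare_eq R, Function.update_of_ne (hne _ _ (by omega) (by omega)), ← homeSquare_eq,
      h.home]
  · rw [Function.update_of_ne (hne _ _ (by omega) (by omega)), h.marks j' hj']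
  · rw [Function.update_of_ne (hne _ _ (by omega) (by omega)), h.mem j']

theorem Represents.update_mem {R : ℕ} {d : Data} {τ : ℕ → Bool} (h : Represents R d τ)
    (hd : d.rem ≤ d.inp) (j : ℕ) (b : Bool) :
    Represents R { d with store := { d.store with mem := Function.update d.store.mem j b } }
      (Function.update τ (square R d.inp j (R + 1)) b) := by
  have hlt : ∀ i, i < d.inp + 4 → i ≠ square R d.inp j (R + 1) :=
    fun i hi => ne_square_of_lt hi j (R + 1)
  have hne : ∀ j', square R d.inp j' 0 ≠ square R d.inp j (R + 1) := by
    intro j' h3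
    have := ((square_inj (by omega) (by omega)).1 h3).2
    omega
  refine ⟨?_, ?_, fun i hi => ?_, fun i hi hi' => ?_, ?_, fun j' hj' => ?_, fun j' => ?_⟩
  · rw [Function.update_of_ne (hlt 0 (by omega)), h.out]
  · rw [Function.update_of_ne (hlt 1 (by omega)), h.gap]
  · dsimp only at hi
    rw [Function.update_of_ne (hlt _ (by omega)), h.ones i hi]
  · dsimp only at hi hi'
    rw [Function.update_of_ne (hlt _ (by omega)), h.zeros i hi hi']
  · dsimp only
    rw [homeSquare_eq R, Function.update_of_ne (hne _), ← homeSquare_eq, h.home]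
  · dsimp only
    rw [Function.update_of_ne (hne _), h.marks j' hj']
  · dsimp only
    rcases eq_or_ne j' j with rfl | hj
    · simp
    · rw [Function.update_of_ne hj, ← h.mem j', Function.update_of_ne]
      exact fun h3 => hj ((square_inj (by omega) (by omega)).1 h3).1

theorem RepresentsReg.update_of_ne {R n : ℕ} {ρ : ℕ → ℕ} {τ : ℕ → Bool}
    (h : RepresentsReg R n ρ τ) {i : ℕ} (b : Bool)
    (hi : ∀ j t, 1 ≤ t → t ≤ R → square R n j t ≠ i) :
    RepresentsReg R n ρ (Function.update τ i b) := by
  intro r hr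
  refine ⟨fun j hj => ?_, ?_⟩
  · rw [Function.update_of_ne (hi _ _ (by omega) (by omega))]
    exact (h r hr).1 j hj
  · rw [Function.update_of_ne (hi _ _ (by omega) (by omega))]
    exact (h r hr).2

/-- A change of one register is represented if its own track is correct and the other tracks are the
same as before. -/
theorem RepresentsReg.update_register {R n : ℕ} {ρ : ℕ → ℕ} {τ τ' : ℕ → Bool}
    (h : RepresentsReg R n ρ τ) {r v : ℕ}
    (ho : ∀ j t, t < R + 2 → t ≠ r + 1 → τ' (square R n j t) = τ (square R n j t))
    (h1 : ∀ j < v, τ' (square R n j (r + 1)) = true) (h2 : τ' (square R n v (r + 1)) = false) :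
    RepresentsReg R n (Function.update ρ r v) τ' := by
  intro r' hr'
  rcases eq_or_ne r' r with rfl | hne
  · rw [Function.update_self]
    exact ⟨h1, h2⟩
  · rw [Function.update_of_ne hne]
    refine ⟨fun j hj => ?_, ?_⟩
    · rw [ho _ _ (by omega) (by omega)]
      exact (h r' hr').1 j hj
    · rw [ho _ _ (by omega) (by omega)]
      exact (h r' hr').2

section Simulation

variable (C : L → Instr L) (R : ℕ) [Finite L] (l₀ : L) (Q : (ℕ → Bool) → Prop)

/-- One step of the machine between two tapes with the property `Q`. -/
def Rel (a b : (machine C R l₀).Config) : Prop :=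
  tapeStep C R l₀ a = b ∧ Q a.tape ∧ Q b.tape

/-- The configuration of the machine with the given components. -/
def mk (q : State L R) (p : ℕ) (τ : ℕ → Bool) : (machine C R l₀).Config := ⟨q, p, τ⟩

variable {C R l₀ Q}

theorem rel_right {q q' : State L R} {p : ℕ} {τ : ℕ → Bool} (b : Bool)
    (h : delta C R q (τ p) = (b, .right, q')) (hQ : Q τ) (hQ' : Q (Function.update τ p b)) :
    Rel C R l₀ Q (mk C R l₀ q p τ) (mk C R l₀ q' (p + 1) (Function.update τ p b)) := by
  refine ⟨?_, hQ, hQ'⟩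
  simp [tapeStep, mk, h, InfiniteTimeTM.moveHead]

theorem rel_left {q q' : State L R} {p : ℕ} {τ : ℕ → Bool} (b : Bool)
    (h : delta C R q (τ p) = (b, .left, q')) (hQ : Q τ) (hQ' : Q (Function.update τ p b)) :
    Rel C R l₀ Q (mk C R l₀ q p τ) (mk C R l₀ q' (p - 1) (Function.update τ p b)) := by
  refine ⟨?_, hQ, hQ'⟩
  simp [tapeStep, mk, h, InfiniteTimeTM.moveHead]

theorem rel_right_keep {q q' : State L R} {p : ℕ} {τ : ℕ → Bool}
    (h : delta C R q (τ p) = (τ p, .right, q')) (hQ : Q τ) :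
    Rel C R l₀ Q (mk C R l₀ q p τ) (mk C R l₀ q' (p + 1) τ) := by
  have := rel_right (l₀ := l₀) (Q := Q) _ h hQ (by rwa [Function.update_eq_self])
  rwa [Function.update_eq_self] at this

theorem rel_left_keep {q q' : State L R} {p : ℕ} {τ : ℕ → Bool}
    (h : delta C R q (τ p) = (τ p, .left, q')) (hQ : Q τ) :
    Rel C R l₀ Q (mk C R l₀ q p τ) (mk C R l₀ q' (p - 1) τ) := by
  have := rel_left (l₀ := l₀) (Q := Q) _ h hQ (by rwa [Function.update_eq_self])
  rwa [Function.update_eq_self] at this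

theorem scan_right {τ : ℕ → Bool} (hQ : Q τ) (st : ℕ → State L R) (p i : ℕ) :
    ∀ n, (∀ k < n, delta C R (st (i + k)) (τ (p + k)) = (τ (p + k), .right, st (i + k + 1))) →
    Relation.ReflTransGen (Rel C R l₀ Q) (mk C R l₀ (st i) p τ) (mk C R l₀ (st (i + n)) (p + n) τ)
  | 0, _ => .refl
  | n + 1, h => (scan_right hQ st p i n fun k hk => h k (by omega)).tail
      (rel_right_keep (h n n.lt_succ_self) hQ)

theorem scan_left {τ : ℕ → Bool} (hQ : Q τ) (st : ℕ → State L R) (p i : ℕ) :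
    ∀ n, (∀ k < n, delta C R (st (i + k + 1)) (τ (p + k + 1)) = (τ (p + k + 1), .left, st (i + k))) →
    Relation.ReflTransGen (Rel C R l₀ Q) (mk C R l₀ (st (i + n)) (p + n) τ) (mk C R l₀ (st i) p τ)
  | 0, _ => .refl
  | n + 1, h => .head (rel_left_keep (h n n.lt_succ_self) hQ)
      (scan_left hQ st p i n fun k hk => h k (by omega))

theorem scan_home {d : Data} {τ : ℕ → Bool} (hτ : Represents R d τ) (hQ : Q τ) (l : L) (i : ℕ) :
    Relation.ReflTransGen (Rel C R l₀ Q)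
      (mk C R l₀ (.home, l, (i : ZMod (R + 2))) (homeSquare d.inp + i) τ)
      (mk C R l₀ (.home, l, 0) (homeSquare d.inp) τ) := by
  have := scan_left (C := C) (l₀ := l₀) hQ (fun i => ((.home, l, (i : ZMod (R + 2))) : State L R))
    (homeSquare d.inp) 0 i ?_
  · simpa using this
  · intro k _
    rw [delta, if_neg, Nat.cast_succ, add_sub_cancel_right]
    rintro ⟨h0, h1⟩
    rw [Nat.zero_add, ← Nat.cast_zero, cast_eq_cast_iff (by omega)] at h0
    obtain ⟨j, hj⟩ := Nat.dvd_of_mod_eq_zero h0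
    have hj1 : 1 ≤ j := by
      rcases Nat.eq_zero_or_pos j with rfl | h
      · omega
      · exact h
    have := hτ.marks j hj1
    rw [square, Nat.add_zero, ← hj, ← Nat.add_assoc, h1] at this
    exact Bool.noConfusion this

/-- After a move to the left from a square of positive offset, the machine goes home. -/
theorem rel_left_home {d : Data} {τ : ℕ → Bool} {q : State L R} {l : L} {i : ℕ} (b : Bool)
    (hi : 1 ≤ i) (h : delta C R q (τ (homeSquare d.inp + i)) =
      (b, .left, (.home, l, (i : ZMod (R + 2)) - 1))) (hQ : Q τ)
    (hτ : Represents R d (Function.update τ (homeSquare d.inp + i) b))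
    (hQ' : Q (Function.update τ (homeSquare d.inp + i) b)) :
    Relation.TransGen (Rel C R l₀ Q) (mk C R l₀ q (homeSquare d.inp + i) τ)
      (mk C R l₀ (.home, l, 0) (homeSquare d.inp)
        (Function.update τ (homeSquare d.inp + i) b)) := by
  refine .head' (rel_left b h hQ hQ') ?_
  have := scan_home (C := C) (l₀ := l₀) hτ hQ' l (i - 1)
  rwa [Nat.cast_sub hi, Nat.cast_one, ← Nat.add_sub_assoc hi] at this

/-- The machine moves to the right as long as it is not on a given track. -/
theorem scan_track {τ : ℕ → Bool} (hQ : Q τ) {ph : Phase} {l : L} {n t i m : ℕ} (ht : t < R + 2)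
    (hδ : ∀ (u : ZMod (R + 2)) (s : Bool), u ≠ (t : ZMod (R + 2)) →
      delta C R (ph, l, u) s = (s, .right, (ph, l, u + 1)))
    (hi : ∀ k < m, (i + k) % (R + 2) ≠ t) :
    Relation.ReflTransGen (Rel C R l₀ Q)
      (mk C R l₀ (ph, l, (i : ZMod (R + 2))) (homeSquare n + i) τ)
      (mk C R l₀ (ph, l, ((i + m : ℕ) : ZMod (R + 2))) (homeSquare n + (i + m)) τ) := by
  have := scan_right (C := C) (l₀ := l₀) hQ (fun i => ((ph, l, (i : ZMod (R + 2))) : State L R))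
    (homeSquare n + i) i m ?_
  · rwa [Nat.add_assoc] at this
  · intro k hk
    rw [hδ, Nat.cast_succ]
    rw [Ne, cast_eq_cast_iff ht]
    exact hi k hk

/-- The machine moves to the right to the first `0` on the track of a register. -/
theorem scan_register {ρ : ℕ → ℕ} {τ : ℕ → Bool} (hQ : Q τ) {n : ℕ} (hτ : RepresentsReg R n ρ τ)
    {ph : Phase} {l : L} {r i : ℕ} (hr : r < R)
    (hδ : ∀ (u : ZMod (R + 2)) (s : Bool), ¬ (u = ((r + 1 : ℕ) : ZMod (R + 2)) ∧ s = false) →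
      delta C R (ph, l, u) s = (s, .right, (ph, l, u + 1)))
    (hi : i ≤ (R + 2) * ρ r + (r + 1)) :
    Relation.ReflTransGen (Rel C R l₀ Q)
      (mk C R l₀ (ph, l, (i : ZMod (R + 2))) (homeSquare n + i) τ)
      (mk C R l₀ (ph, l, ((r + 1 : ℕ) : ZMod (R + 2))) (square R n (ρ r) (r + 1)) τ) := by
  obtain ⟨m, hm⟩ := Nat.exists_eq_add_of_le hi
  have := scan_right (C := C) (l₀ := l₀) hQ (fun i => ((ph, l, (i : ZMod (R + 2))) : State L R))
    (homeSquare n + i) i m ?_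
  · rwa [Nat.add_assoc, ← hm, cast_mul_add] at this
  · intro k hk
    rw [hδ, Nat.cast_succ]
    rintro ⟨h0, h1⟩
    rw [cast_eq_cast_iff (by omega)] at h0
    have hd := Nat.div_add_mod (i + k) (R + 2)
    rw [h0] at hd
    have hlt : (i + k) / (R + 2) < ρ r := by
      refine Nat.lt_of_mul_lt_mul_left (a := R + 2) ?_
      omega
    have := (hτ r hr).1 _ hlt
    rw [square, hd, ← Nat.add_assoc, h1] at this
    exact Bool.noConfusion this

end Simulation

end TapeMachine

/-! ### Simulation of single instructions -/

namespace TapeMachine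

open RegisterMachine

variable {L : Type}

section Instructions

variable {C : L → Instr L} {R : ℕ} [Finite L] {l₀ : L} {Q : (ℕ → Bool) → Prop}
variable {d : Data} {ρ : ℕ → ℕ} {τ : ℕ → Bool} {l l' : L}

theorem add_succ_mod_ne {R v t k : ℕ} (hk : k < R + 1) :
    ((R + 2) * v + t + 1 + k) % (R + 2) ≠ t := by
  intro h
  have hd := Nat.div_add_mod ((R + 2) * v + t + 1 + k) (R + 2)
  rw [h] at hd
  set q := ((R + 2) * v + t + 1 + k) / (R + 2)
  have hvq : v < q := by
    refine Nat.lt_of_mul_lt_mul_left (a := R + 2) ?_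
    omega
  have := Nat.mul_le_mul_left (R + 2) (Nat.succ_le_of_lt hvq)
  rw [Nat.mul_succ] at this
  omega

/-- The beginning of an instruction that works to the right of the home square. -/
theorem rel_seek (hτ : Represents R d τ) (hQ : Q τ)
    (h : dispatch C R l = (.right, (.seek, l, 1))) :
    Rel C R l₀ Q (mk C R l₀ (.home, l, 0) (homeSquare d.inp) τ)
      (mk C R l₀ (.seek, l, ((1 : ℕ) : ZMod (R + 2))) (homeSquare d.inp + 1) τ) := by
  refine rel_right_keep ?_ hQ
  rw [delta, if_pos ⟨rfl, hτ.home⟩, h, Nat.cast_one]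

/-- The square after the new end of the register is cleared, since it may hold garbage. -/
theorem simulate_inc (hτ : Represents R d τ) (hρ : RepresentsReg R d.inp ρ τ)
    (hd : d.rem ≤ d.inp) (hQ : ∀ τ, Represents R d τ → Q τ) {r : ℕ} (hr : r < R)
    (hC : C l = .inc r l') :
    ∃ τ', Represents R d τ' ∧ RepresentsReg R d.inp (Function.update ρ r (ρ r + 1)) τ' ∧
      Relation.TransGen (Rel C R l₀ Q) (mk C R l₀ (.home, l, 0) (homeSquare d.inp) τ)
        (mk C R l₀ (.home, l', 0) (homeSquare d.inp) τ') := by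
  set v := ρ r with hv
  set τ₁ := Function.update τ (square R d.inp v (r + 1)) true with h1
  have hτ₁ : Represents R d τ₁ := hτ.update_reg hd (by omega) (by omega) _
  set τ₂ := Function.update τ₁ (square R d.inp (v + 1) (r + 1)) false with h2
  have hτ₂ : Represents R d τ₂ := hτ₁.update_reg hd (by omega) (by omega) _
  have hvs : τ (square R d.inp v (r + 1)) = false := (hρ r hr).2
  have hsq : square R d.inp v (r + 1) + 1 =
      homeSquare d.inp + ((R + 2) * v + (r + 1) + 1) := by unfold square; omega
  have hsq' : square R d.inp (v + 1) (r + 1) =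
      homeSquare d.inp + ((R + 2) * v + (r + 1) + 1 + (R + 1)) := by
    unfold square
    rw [Nat.mul_succ]
    omega
  have hcast : (((R + 2) * v + (r + 1) + 1 + (R + 1) : ℕ) : ZMod (R + 2)) = ((r + 1 : ℕ)) := by
    rw [show (R + 2) * v + (r + 1) + 1 + (R + 1) = (R + 2) * (v + 1) + (r + 1) by
      rw [Nat.mul_succ]; omega]
    exact cast_mul_add _ _ _
  refine ⟨τ₂, hτ₂, ?_, ?_⟩
  · refine hρ.update_register (fun j t ht hne => ?_) (fun j hj => ?_) ?_
    · have : ∀ j', square R d.inp j t ≠ square R d.inp j' (r + 1) :=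
        fun j' h => hne ((square_inj ht (by omega)).1 h).2
      rw [h2, Function.update_of_ne (this _), h1, Function.update_of_ne (this _)]
    · rw [h2, Function.update_of_ne, h1]
      · rcases eq_or_ne j v with rfl | hjv
        · simp
        · rw [Function.update_of_ne]
          · exact (hρ r hr).1 j (by omega)
          · exact fun h => hjv ((square_inj (by omega) (by omega)).1 h).1
      · intro h
        have := ((square_inj (by omega) (by omega)).1 h).1
        omega
    · simp [h2]
  · refine .head' (rel_seek hτ (hQ τ hτ) (by simp [dispatch, hC])) ?_
    refine Relation.TransGen.to_reflTransGen ?_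
    refine .trans_right (scan_register (hQ τ hτ) hρ hr (fun u s h => ?_) (by omega)) ?_
    · simp only [delta, seekMove, hC]
      rw [if_neg h]
    · refine .head (rel_right (q' := (.second, l, ((r + 1 : ℕ) : ZMod (R + 2)) + 1)) true ?_
        (hQ τ hτ) (hQ _ hτ₁)) ?_
      · simp [delta, seekMove, hC, ← hv, hvs]
      · rw [← hv, ← h1, hsq]
        have hscan := scan_track (C := C) (R := R) (l₀ := l₀) (hQ _ hτ₁) (ph := .second) (l := l)
          (n := d.inp) (t := r + 1) (i := (R + 2) * v + (r + 1) + 1) (m := R + 1) (by omega)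
          (fun u s h => by simp only [delta, secondMove, hC]; rw [if_neg h])
          (fun k hk => add_succ_mod_ne hk)
        rw [Nat.cast_succ, cast_mul_add] at hscan
        refine .trans_right hscan ?_
        have hlast := rel_left_home (C := C) (l₀ := l₀) (Q := Q) (d := d) (τ := τ₁) (l := l')
          (q := (.second, l, (((R + 2) * v + (r + 1) + 1 + (R + 1) : ℕ) : ZMod (R + 2))))
          (i := (R + 2) * v + (r + 1) + 1 + (R + 1)) false (by omega) ?_ (hQ _ hτ₁)
          (by rwa [← hsq']) (by rw [← hsq']; exact hQ _ hτ₂)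
        · rwa [← hsq'] at hlast ⊢
        · rw [hcast]
          simp [delta, secondMove, hC]

theorem simulate_dec (hτ : Represents R d τ) (hρ : RepresentsReg R d.inp ρ τ)
    (hd : d.rem ≤ d.inp) (hQ : ∀ τ, Represents R d τ → Q τ) {r : ℕ} (hr : r < R)
    (hC : C l = .dec r l') :
    ∃ τ', Represents R d τ' ∧ RepresentsReg R d.inp (Function.update ρ r (ρ r - 1)) τ' ∧
      Relation.TransGen (Rel C R l₀ Q) (mk C R l₀ (.home, l, 0) (homeSquare d.inp) τ)
        (mk C R l₀ (.home, l', 0) (homeSquare d.inp) τ') := by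
  have hstart : Relation.ReflTransGen (Rel C R l₀ Q) (mk C R l₀ (.home, l, 0) (homeSquare d.inp) τ)
      (mk C R l₀ (.seek, l, ((r + 1 : ℕ) : ZMod (R + 2))) (homeSquare d.inp + (r + 1)) τ) := by
    refine .head (rel_seek hτ (hQ τ hτ) (by simp [dispatch, hC])) ?_
    have := scan_track (C := C) (R := R) (l₀ := l₀) (hQ _ hτ) (ph := .seek) (l := l)
      (n := d.inp) (t := r + 1) (i := 1) (m := r) (by omega)
      (fun u s h => by simp only [delta, seekMove, hC]; rw [if_neg h])
      (fun k hk => by rw [Nat.mod_eq_of_lt (by omega)]; omega)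
    rwa [Nat.add_comm 1 r] at this
  have hsq0 : homeSquare d.inp + (r + 1) = square R d.inp 0 (r + 1) := by
    unfold square; omega
  rcases hv : ρ r with _ | v
  · have hs : τ (homeSquare d.inp + (r + 1)) = false := by
      rw [hsq0]
      have := (hρ r hr).2
      rwa [hv] at this
    refine ⟨τ, hτ, ?_, ?_⟩
    · rwa [Nat.zero_sub, ← hv, Function.update_eq_self]
    · refine .trans_right hstart ?_
      have hu : Function.update τ (homeSquare d.inp + (r + 1)) false = τ := by
        rw [← hs, Function.update_eq_self]
      have hlast := rel_left_home (C := C) (l₀ := l₀) (Q := Q) (d := d) (τ := τ) (l := l')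
        (q := (.seek, l, ((r + 1 : ℕ) : ZMod (R + 2)))) (i := r + 1) false (by omega) ?_
        (hQ _ hτ) (by rwa [hu]) (by rw [hu]; exact hQ _ hτ)
      · rwa [hu] at hlast
      · simp [delta, seekMove, hC, hs]
  · have hs : τ (homeSquare d.inp + (r + 1)) = true := by
      rw [hsq0]
      exact (hρ r hr).1 0 (by omega)
    have hs' : τ (square R d.inp (v + 1) (r + 1)) = false := by
      have := (hρ r hr).2
      rwa [hv] at this
    set τ' := Function.update τ (square R d.inp v (r + 1)) false with h'
    have hτ' : Represents R d τ' := hτ.update_reg hd (by omega) (by omega) _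
    refine ⟨τ', hτ', ?_, ?_⟩
    · refine hρ.update_register (fun j t ht hne => ?_) (fun j hj => ?_) ?_
      · rw [h', Function.update_of_ne fun h => hne ((square_inj ht (by omega)).1 h).2]
      · rw [h', Function.update_of_ne]
        · exact (hρ r hr).1 j (by omega)
        · intro h
          have := ((square_inj (by omega) (by omega)).1 h).1
          omega
      · simp [h']
    · refine .trans_right hstart ?_
      refine .head (rel_right_keep
        (q' := (.second, l, (((r + 1) + 1 : ℕ) : ZMod (R + 2)))) ?_ (hQ τ hτ)) ?_
      · rw [Nat.cast_succ (r + 1)]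
        simp [delta, seekMove, hC, hs]
      · rw [Nat.add_assoc]
        have hle : r + 1 + 1 ≤ (R + 2) * ρ r + (r + 1) := by
          rw [hv, Nat.mul_succ]
          omega
        refine .trans_right (scan_register (hQ τ hτ) hρ hr (fun u s h => ?_) hle) ?_
        · simp only [delta, secondMove, hC]
          rw [if_neg h]
        · rw [hv]
          have hsq : square R d.inp (v + 1) (r + 1) - 1 = square R d.inp v (r + 1) + (R + 1) := by
            unfold square
            rw [Nat.mul_succ]
            omega
          have hcast : ((r + 1 : ℕ) : ZMod (R + 2)) - 1 =
              (((R + 2) * v + (r + 1) + (R + 1) : ℕ) : ZMod (R + 2)) := by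
            have : (((R + 2) * (v + 1) + (r + 1) : ℕ) : ZMod (R + 2)) = ((r + 1 : ℕ)) :=
              cast_mul_add _ _ _
            rw [← this, show (R + 2) * (v + 1) + (r + 1) = (R + 2) * v + (r + 1) + (R + 1) + 1 by
              rw [Nat.mul_succ]; omega, Nat.cast_succ, add_sub_cancel_right]
          refine .head (rel_left_keep (q' := (.back, l, ((r + 1 : ℕ) : ZMod (R + 2)) - 1)) ?_
            (hQ τ hτ)) ?_
          · simp [delta, secondMove, hC, hs']
          · rw [hsq, hcast]
            have hscan := scan_left (C := C) (l₀ := l₀) (hQ τ hτ)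
              (fun i => ((.back, l, (i : ZMod (R + 2))) : State L R)) (square R d.inp v (r + 1))
              ((R + 2) * v + (r + 1)) (R + 1) ?_
            · refine .trans_right hscan ?_
              have hlast := rel_left_home (C := C) (l₀ := l₀) (Q := Q) (d := d) (τ := τ) (l := l')
                (q := (.back, l, (((R + 2) * v + (r + 1) : ℕ) : ZMod (R + 2))))
                (i := (R + 2) * v + (r + 1)) false (by omega) ?_ (hQ _ hτ) hτ' (hQ _ hτ')
              · exact hlast
              · rw [cast_mul_add]
                simp [delta, backMove, hC]
            · intro k hk
              simp only [delta, backMove, hC]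
              rw [if_neg, Nat.cast_succ, add_sub_cancel_right]
              rw [cast_eq_cast_iff (by omega), Nat.add_right_comm]
              exact add_succ_mod_ne hk

/-- The machine goes to the memory square whose address is in the register `r`. -/
theorem scan_memory (hτ : Represents R d τ) (hρ : RepresentsReg R d.inp ρ τ) (hQ : Q τ) {r : ℕ}
    (hr : r < R) (hdis : dispatch C R l = (.right, (.seek, l, 1)))
    (hseek : ∀ (u : ZMod (R + 2)) (s : Bool), seekMove C R l u s =
      if u = ((r + 1 : ℕ) : ZMod (R + 2)) ∧ s = false then (s, .right, (.second, l, u + 1))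
      else (s, .right, (.seek, l, u + 1)))
    (hsec : ∀ (u : ZMod (R + 2)) (s : Bool), u ≠ ((R + 1 : ℕ) : ZMod (R + 2)) →
      secondMove C R l u s = (s, .right, (.second, l, u + 1))) :
    Relation.ReflTransGen (Rel C R l₀ Q) (mk C R l₀ (.home, l, 0) (homeSquare d.inp) τ)
      (mk C R l₀ (.second, l, ((R + 1 : ℕ) : ZMod (R + 2))) (square R d.inp (ρ r) (R + 1)) τ) := by
  refine .head (rel_seek hτ hQ hdis) ?_
  refine .trans (scan_register hQ hρ hr (fun u s h => ?_) (by omega)) ?_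
  · rw [delta, hseek, if_neg h]
  · set v := ρ r with hv
    have hvs : τ (square R d.inp v (r + 1)) = false := (hρ r hr).2
    refine .head (rel_right_keep (q' := (.second, l, ((r + 1 : ℕ) : ZMod (R + 2)) + 1)) ?_ hQ) ?_
    · simp [delta, hseek, hvs]
    · have hscan := scan_track (C := C) (R := R) (l₀ := l₀) hQ (ph := .second) (l := l)
        (n := d.inp) (t := R + 1) (i := (R + 2) * v + (r + 1) + 1) (m := R - 1 - r) (by omega)
        (fun u s h => by rw [delta, hsec u s h])
        (fun k hk => by
          rw [show (R + 2) * v + (r + 1) + 1 + k = (R + 2) * v + (r + 1 + 1 + k) by omega,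
            mul_add_mod_of_lt (by omega)]
          omega)
      rw [show (R + 2) * v + (r + 1) + 1 + (R - 1 - r) = (R + 2) * v + (R + 1) by omega,
        Nat.cast_succ, cast_mul_add, cast_mul_add] at hscan
      exact hscan

theorem simulate_write (hτ : Represents R d τ) (hρ : RepresentsReg R d.inp ρ τ)
    (hd : d.rem ≤ d.inp) (hQ : ∀ τ, Represents R d τ → Q τ) {r : ℕ} {b : Bool}
    (hQ' : ∀ τ, Represents R { d with store :=
      { d.store with mem := Function.update d.store.mem (ρ r) b } } τ → Q τ) (hr : r < R)
    (hC : C l = .write r b l') :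
    ∃ τ', Represents R { d with store :=
        { d.store with mem := Function.update d.store.mem (ρ r) b } } τ' ∧
      RepresentsReg R d.inp ρ τ' ∧
      Relation.TransGen (Rel C R l₀ Q) (mk C R l₀ (.home, l, 0) (homeSquare d.inp) τ)
        (mk C R l₀ (.home, l', 0) (homeSquare d.inp) τ') := by
  have hτ' := hτ.update_mem hd (ρ r) b
  refine ⟨_, hτ', hρ.update_of_ne b fun j t _ ht h => ?_, ?_⟩
  · have := ((square_inj (by omega) (by omega)).1 h).2
    omega
  · refine .trans_right (scan_memory hτ hρ (hQ τ hτ) hr (by simp [dispatch, hC])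
      (fun u s => by simp only [seekMove, hC])
      (fun u s h => by simp only [secondMove, hC]; rw [if_neg h])) ?_
    refine rel_left_home (d := { d with store :=
        { d.store with mem := Function.update d.store.mem (ρ r) b } })
      (i := (R + 2) * ρ r + (R + 1)) b (by omega) ?_ (hQ _ hτ) hτ' (hQ' _ hτ')
    rw [cast_mul_add]
    simp [delta, secondMove, hC]

theorem simulate_bit (hτ : Represents R d τ) (hρ : RepresentsReg R d.inp ρ τ)
    (hQ : Q τ) {r : ℕ} (hr : r < R) {l₁ l₂ : L} (hC : C l = .test (.bit r) l₁ l₂) :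
    Relation.TransGen (Rel C R l₀ Q) (mk C R l₀ (.home, l, 0) (homeSquare d.inp) τ)
      (mk C R l₀ (.home, if d.store.mem (ρ r) = true then l₁ else l₂, 0)
        (homeSquare d.inp) τ) := by
  refine .trans_right (scan_memory hτ hρ hQ hr (by simp [dispatch, hC])
    (fun u s => by simp only [seekMove, hC])
    (fun u s h => by simp only [secondMove, hC]; rw [if_neg h])) ?_
  have hs := hτ.mem (ρ r)
  have hu : Function.update τ (square R d.inp (ρ r) (R + 1)) (d.store.mem (ρ r)) = τ := by
    rw [← hs, Function.update_eq_self]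
  have hlast := rel_left_home (C := C) (l₀ := l₀) (Q := Q) (d := d) (τ := τ)
    (l := if d.store.mem (ρ r) = true then l₁ else l₂)
    (q := (.second, l, ((R + 1 : ℕ) : ZMod (R + 2))))
    (i := (R + 2) * ρ r + (R + 1)) (d.store.mem (ρ r)) (by omega) ?_ hQ
    (by change Represents R d (Function.update τ (square R d.inp (ρ r) (R + 1)) _); rwa [hu])
    (by change Q (Function.update τ (square R d.inp (ρ r) (R + 1)) _); rwa [hu])
  · change Relation.TransGen _ (mk C R l₀ _ (square R d.inp (ρ r) (R + 1)) τ)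
      (mk C R l₀ _ _ (Function.update τ (square R d.inp (ρ r) (R + 1)) _)) at hlast
    rwa [hu] at hlast
  · change delta C R _ (τ (square R d.inp (ρ r) (R + 1))) = _
    rw [hs, cast_mul_add]
    simp [delta, secondMove, hC]

theorem simulate_nonzero (hτ : Represents R d τ) (hρ : RepresentsReg R d.inp ρ τ)
    (hQ : Q τ) {r : ℕ} (hr : r < R) {l₁ l₂ : L} (hC : C l = .test (.nonzero r) l₁ l₂) :
    Relation.TransGen (Rel C R l₀ Q) (mk C R l₀ (.home, l, 0) (homeSquare d.inp) τ)
      (mk C R l₀ (.home, if decide (ρ r ≠ 0) = true then l₁ else l₂, 0)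
        (homeSquare d.inp) τ) := by
  refine .head' (rel_seek hτ hQ (by simp [dispatch, hC])) ?_
  refine Relation.TransGen.to_reflTransGen ?_
  have hscan := scan_track (C := C) (R := R) (l₀ := l₀) hQ (ph := .seek) (l := l)
    (n := d.inp) (t := r + 1) (i := 1) (m := r) (by omega)
    (fun u s h => by simp only [delta, seekMove, hC]; rw [if_neg h])
    (fun k hk => by rw [Nat.mod_eq_of_lt (by omega)]; omega)
  rw [Nat.add_comm 1 r] at hscan
  refine .trans_right hscan ?_
  have hs : τ (homeSquare d.inp + (r + 1)) = decide (ρ r ≠ 0) := by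
    have hsq0 : homeSquare d.inp + (r + 1) = square R d.inp 0 (r + 1) := by
      unfold square; omega
    rw [hsq0]
    rcases hv : ρ r with _ | v
    · have := (hρ r hr).2
      rw [hv] at this
      simpa using this
    · simpa using (hρ r hr).1 0 (by omega)
  have hu : Function.update τ (homeSquare d.inp + (r + 1)) (decide (ρ r ≠ 0)) = τ := by
    rw [← hs, Function.update_eq_self]
  have hlast := rel_left_home (C := C) (l₀ := l₀) (Q := Q) (d := d) (τ := τ)
    (l := if decide (ρ r ≠ 0) = true then l₁ else l₂)
    (q := (.seek, l, ((r + 1 : ℕ) : ZMod (R + 2)))) (i := r + 1) (decide (ρ r ≠ 0)) (by omega) ?_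
    hQ (by rwa [hu]) (by rwa [hu])
  · rwa [hu] at hlast
  · rw [hs]
    simp only [delta, seekMove, hC, if_true]

/-- The way back to the home square through the zeros to the left of it. -/
theorem return_zeros (hτ : Represents R d τ) (hQ : Q τ) {p : ℕ} (hp : d.rem + 3 ≤ p)
    (hp' : p ≤ homeSquare d.inp) :
    Relation.TransGen (Rel C R l₀ Q) (mk C R l₀ (.rightZeros, l, 0) p τ)
      (mk C R l₀ (.home, l, 0) (homeSquare d.inp) τ) := by
  obtain ⟨n, hn⟩ := Nat.exists_eq_add_of_le hp'
  have hscan := scan_right (C := C) (l₀ := l₀) hQ (fun _ => ((.rightZeros, l, 0) : State L R))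
    p 0 n ?_
  · rw [← hn] at hscan
    refine .trans_right hscan (.head (rel_left_keep (q' := (.rightEnd, l, 0)) ?_ hQ) (.single ?_))
    · simp [delta, hτ.home]
    · exact rel_right_keep (p := d.inp + 3) (q' := (.home, l, 0)) rfl hQ
  · intro k hk
    have : τ (p + k) = false := by
      have := hτ.zeros (p + k - 2) (by omega) (by unfold homeSquare at hn; omega)
      rwa [show 2 + (p + k - 2) = p + k by omega] at this
    simp [delta, this]

/-- The way back to the home square from the beginning of the tape. -/
theorem return_gap (hτ : Represents R d τ) (hd : d.rem ≤ d.inp) (hQ : Q τ) :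
    Relation.TransGen (Rel C R l₀ Q) (mk C R l₀ (.rightGap, l, 0) 1 τ)
      (mk C R l₀ (.home, l, 0) (homeSquare d.inp) τ) := by
  refine .head (rel_right_keep (q' := (.rightOnes, l, 0)) rfl hQ) ?_
  have hscan := scan_right (C := C) (l₀ := l₀) hQ (fun _ => ((.rightOnes, l, 0) : State L R))
    2 0 (d.rem + 1) ?_
  · refine .trans_right hscan (.head (rel_right_keep (q' := (.rightZeros, l, 0)) ?_ hQ) ?_)
    · have := hτ.zeros (d.rem + 1) (by omega) (by omega)
      simp [delta, this]
    · exact return_zeros hτ hQ (by omega) (by unfold homeSquare; omega)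
  · intro k hk
    simp [delta, hτ.ones k (by omega)]

/-- The beginning of an instruction that works to the left of the home square. -/
theorem scan_ones (hτ : Represents R d τ) (hd : d.rem ≤ d.inp) (hQ : Q τ)
    (h : dispatch C R l = (.left, (.left, l, 0))) :
    Relation.TransGen (Rel C R l₀ Q) (mk C R l₀ (.home, l, 0) (homeSquare d.inp) τ)
      (mk C R l₀ (onesPhase C l, l, 0) (d.rem + 1) τ) := by
  refine .head (rel_left_keep (q' := (.left, l, 0)) ?_ hQ) ?_
  · rw [delta, if_pos ⟨rfl, hτ.home⟩, h]
  · have hscan := scan_left (C := C) (l₀ := l₀) hQ (fun _ => ((.left, l, 0) : State L R))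
      (d.rem + 2) 0 (d.inp + 1 - d.rem) ?_
    · rw [show d.rem + 2 + (d.inp + 1 - d.rem) = homeSquare d.inp - 1 by
        unfold homeSquare; omega] at hscan
      refine .trans_right hscan (.single (rel_left_keep ?_ hQ))
      have := hτ.ones d.rem le_rfl
      rw [Nat.add_comm] at this
      simp [delta, this]
    · intro k hk
      have := hτ.zeros (d.rem + k + 1) (by omega) (by omega)
      rw [show 2 + (d.rem + k + 1) = d.rem + 2 + k + 1 by omega] at this
      simp [delta, this]

theorem simulate_out (hτ : Represents R d τ) (hρ : RepresentsReg R d.inp ρ τ)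
    (hd : d.rem ≤ d.inp) (hQ : ∀ τ, Represents R d τ → Q τ) {b : Bool}
    (hQ' : ∀ τ, Represents R { d with store := { d.store with out := b } } τ → Q τ)
    (hC : C l = .out b l') :
    ∃ τ', Represents R { d with store := { d.store with out := b } } τ' ∧
      RepresentsReg R d.inp ρ τ' ∧
      Relation.TransGen (Rel C R l₀ Q) (mk C R l₀ (.home, l, 0) (homeSquare d.inp) τ)
        (mk C R l₀ (.home, l', 0) (homeSquare d.inp) τ') := by
  have hpos : ∀ j t, square R d.inp j t ≠ 0 := by
    intro j t
    unfold square homeSquare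
    omega
  have hτ' : Represents R { d with store := { d.store with out := b } }
      (Function.update τ 0 b) := by
    refine ⟨by simp, ?_, fun i hi => ?_, fun i hi hi' => ?_, ?_, fun j hj => ?_, fun j => ?_⟩
    · rw [Function.update_of_ne one_ne_zero, hτ.gap]
    · rw [Function.update_of_ne (by omega), hτ.ones i hi]
    · rw [Function.update_of_ne (by omega), hτ.zeros i hi hi']
    · rw [Function.update_of_ne (by unfold homeSquare; omega), hτ.home]
    · rw [Function.update_of_ne (hpos _ _), hτ.marks j hj]
    · rw [Function.update_of_ne (hpos _ _), hτ.mem j]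
  refine ⟨_, hτ', hρ.update_of_ne b fun j t _ _ => hpos j t, ?_⟩
  refine .trans (scan_ones hτ hd (hQ τ hτ) (by simp [dispatch, hC])) ?_
  have hscan := scan_left (C := C) (l₀ := l₀) (hQ τ hτ)
    (fun _ => ((.leftOnes, l, 0) : State L R)) 1 0 d.rem ?_
  · rw [show onesPhase C l = .leftOnes by simp [onesPhase, hC], Nat.add_comm d.rem]
    refine .trans_right hscan ?_
    refine .head (rel_left_keep (q' := (.leftEnd, l, 0)) ?_ (hQ τ hτ)) ?_
    · simp [delta, hτ.gap]
    · refine .head (rel_right (q' := (.rightGap, l', 0)) b ?_ (hQ τ hτ) (hQ' _ hτ')) ?_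
      · simp [delta, outBit, nextLabel, hC]
      · have := return_gap (C := C) (l₀ := l₀) (l := l') hτ' hd (hQ' _ hτ')
        exact this
  · intro k hk
    have := hτ.ones k (by omega)
    rw [show 2 + k = 1 + k + 1 by omega] at this
    simp [delta, this]

/-- There may be other tapes on the way than those that represent the data before or after a request
for input, whence the stronger assumption on `Q`. -/
theorem simulate_take_true (hτ : Represents R d τ) (hρ : RepresentsReg R d.inp ρ τ)
    (hd : d.rem ≤ d.inp) (hQ : ∀ τ, Q τ) {l₁ l₂ : L} (hC : C l = .test .take l₁ l₂)
    (hrem : d.rem ≠ 0) :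
    ∃ τ', Represents R { d with rem := d.rem - 1 } τ' ∧ RepresentsReg R d.inp ρ τ' ∧
      Relation.TransGen (Rel C R l₀ Q) (mk C R l₀ (.home, l, 0) (homeSquare d.inp) τ)
        (mk C R l₀ (.home, l₁, 0) (homeSquare d.inp) τ') := by
  have hpos : ∀ j t, square R d.inp j t ≠ d.rem + 1 + 1 := fun j t =>
    (ne_square_of_lt (by unfold homeSquare; omega) j t).symm
  have hτ' : Represents R { d with rem := d.rem - 1 }
      (Function.update τ (d.rem + 1 + 1) false) := by
    refine ⟨?_, ?_, fun i hi => ?_, fun i hi hi' => ?_, ?_, fun j hj => ?_, fun j => ?_⟩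
    · rw [Function.update_of_ne (by omega), hτ.out]
    · rw [Function.update_of_ne (by omega), hτ.gap]
    · dsimp only at hi
      rw [Function.update_of_ne (by omega), hτ.ones i (by omega)]
    · dsimp only at hi hi'
      rcases eq_or_ne i d.rem with rfl | hne
      · rw [Nat.add_comm 2, Function.update_self]
      · rw [Function.update_of_ne (by omega), hτ.zeros i (by omega) hi']
    · rw [homeSquare_eq R, Function.update_of_ne (hpos _ _), ← homeSquare_eq, hτ.home]
    · rw [Function.update_of_ne (hpos _ _), hτ.marks j hj]
    · rw [Function.update_of_ne (hpos _ _), hτ.mem j]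
  refine ⟨_, hτ', hρ.update_of_ne _ fun j t _ _ => hpos j t, ?_⟩
  refine .trans (scan_ones hτ hd (hQ τ) (by simp [dispatch, hC])) ?_
  rw [show onesPhase C l = .takeCheck by simp [onesPhase, hC]]
  refine .head (rel_right_keep (q' := (.takeOne, l, 0)) ?_ (hQ τ)) ?_
  · have := hτ.ones (d.rem - 1) (by omega)
    rw [show 2 + (d.rem - 1) = d.rem + 1 by omega] at this
    simp [delta, this]
  · refine .head (rel_right (q' := (.rightZeros, l₁, 0)) false ?_ (hQ τ) (hQ _)) ?_
    · simp [delta, nextLabel, hC]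
    · refine return_zeros hτ' (hQ _) ?_ ?_
      · dsimp only
        omega
      · unfold homeSquare
        dsimp only
        omega

/-- On an unsuccessful request, the zeros between the ones and the home square are filled up by ones,
and then the last one of them is erased again. -/
theorem simulate_take_false (hτ : Represents R d τ) (hρ : RepresentsReg R d.inp ρ τ)
    (hd : d.rem ≤ d.inp) (hQ : ∀ τ, Q τ) {l₁ l₂ : L} (hC : C l = .test .take l₁ l₂)
    (hrem : d.rem = 0) :
    ∃ τ', Represents R { d with rem := d.inp } τ' ∧ RepresentsReg R d.inp ρ τ' ∧
      Relation.TransGen (Rel C R l₀ Q) (mk C R l₀ (.home, l, 0) (homeSquare d.inp) τ)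
        (mk C R l₀ (.home, l₂, 0) (homeSquare d.inp) τ') := by
  -- the head reaches the home square with ones everywhere to the left of it
  have hfill : ∀ n ≤ d.inp + 1, Relation.ReflTransGen (Rel C R l₀ Q)
      (mk C R l₀ (.fill, l, 0) 3 τ)
      (mk C R l₀ (.fill, l, 0) (3 + n) fun i => if 3 ≤ i ∧ i < 3 + n then true else τ i) := by
    intro n
    induction n with
    | zero =>
      intro _
      rw [show (fun i => if 3 ≤ i ∧ i < 3 + 0 then true else τ i) = τ by
        funext i; rw [if_neg (by omega)]]
    | succ n ih =>
      intro hn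
      refine (ih (by omega)).tail ?_
      have hs : τ (3 + n) = false := by
        have := hτ.zeros (n + 1) (by omega) (by omega)
        rwa [show 2 + (n + 1) = 3 + n by omega] at this
      convert rel_right (l₀ := l₀) (Q := Q) (q := (.fill, l, 0)) (q' := (.fill, l, 0))
        (p := 3 + n) (τ := fun i => if 3 ≤ i ∧ i < 3 + n then true else τ i) true ?_ (hQ _) (hQ _)
        using 1
      · congr 1
        funext i
        simp only [Function.update_apply]
        grind
      · simp [delta, hs]
  have hpos : ∀ j t, square R d.inp j t = homeSquare d.inp + ((R + 2) * j + t) := fun _ _ => rfl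
  set τ' : ℕ → Bool := fun i =>
    if i = d.inp + 3 then false else if 3 ≤ i ∧ i < d.inp + 4 then true else τ i with h'
  have hge : ∀ i, homeSquare d.inp ≤ i → τ' i = τ i := by
    intro i hi
    unfold homeSquare at hi
    rw [h']
    dsimp only
    rw [if_neg (by omega), if_neg (by omega)]
  have hsq : ∀ j t, τ' (square R d.inp j t) = τ (square R d.inp j t) :=
    fun j t => hge _ (by rw [hpos]; omega)
  refine ⟨τ', ?_, fun r hr => ?_, ?_⟩
  · refine ⟨?_, ?_, fun i hi => ?_, fun i hi hi' => ?_, ?_, fun j hj => ?_, fun j => ?_⟩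
    · simp [h', hτ.out]
    · simp [h', hτ.gap]
    · dsimp only at hi
      simp only [h']
      rw [if_neg (by omega)]
      rcases Nat.eq_zero_or_pos i with rfl | hi0
      · rw [if_neg (by omega), hτ.ones 0 (by omega)]
      · rw [if_pos (by omega)]
    · dsimp only at hi hi'
      simp only [h']
      rw [if_pos (by omega)]
    · rw [hge _ le_rfl, hτ.home]
    · rw [hsq, hτ.marks j hj]
    · rw [hsq, hτ.mem j]
  · rw [hsq]
    refine ⟨fun j hj => ?_, (hρ r hr).2⟩
    rw [hsq]
    exact (hρ r hr).1 j hj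
  · refine .trans (scan_ones hτ hd (hQ τ) (by simp [dispatch, hC])) ?_
    rw [show onesPhase C l = .takeCheck by simp [onesPhase, hC], hrem]
    refine .head (rel_right_keep (q' := (.takeNone, l, 0)) ?_ (hQ τ)) ?_
    · simp [delta, hτ.gap]
    · refine .head (rel_right_keep (q' := (.fill, l, 0)) rfl (hQ τ)) ?_
      refine .trans_right (hfill (d.inp + 1) le_rfl) ?_
      refine .head (rel_left_keep (q' := (.fillEnd, l, 0)) ?_ (hQ _)) (.single ?_)
      · have := hτ.home
        rw [homeSquare, show d.inp + 4 = 3 + (d.inp + 1) by omega] at this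
        simp [delta, this]
      · convert rel_right (l₀ := l₀) (Q := Q) (q := (.fillEnd, l, 0)) (q' := (.home, l₂, 0))
          (p := 3 + (d.inp + 1) - 1)
          (τ := fun i => if 3 ≤ i ∧ i < 3 + (d.inp + 1) then true else τ i) false ?_ (hQ _) (hQ _)
          using 2
        · unfold homeSquare
          omega
        · funext i
          simp only [Function.update_apply, h']
          grind
        · simp [delta, elseLabel, hC]

/-- The instruction `boot` makes no assumption on the registers. -/
theorem simulate_boot (hτ : Represents R d τ) (hd : d.rem ≤ d.inp)
    (hQ : ∀ τ, Represents R d τ → Q τ) (hC : C l = .boot l') :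
    ∃ τ', Represents R d τ' ∧ RepresentsReg R d.inp (fun _ => 0) τ' ∧
      Relation.TransGen (Rel C R l₀ Q) (mk C R l₀ (.home, l, 0) (homeSquare d.inp) τ)
        (mk C R l₀ (.home, l', 0) (homeSquare d.inp) τ') := by
  have hclear : ∀ n ≤ R, ∃ τ', Represents R d τ' ∧
      (∀ t, 1 ≤ t → t ≤ n → τ' (square R d.inp 0 t) = false) ∧
      Relation.ReflTransGen (Rel C R l₀ Q)
        (mk C R l₀ (.seek, l, ((1 : ℕ) : ZMod (R + 2))) (homeSquare d.inp + 1) τ)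
        (mk C R l₀ (.seek, l, ((n + 1 : ℕ) : ZMod (R + 2))) (square R d.inp 0 (n + 1)) τ') := by
    intro n
    induction n with
    | zero =>
      exact fun _ => ⟨τ, hτ, fun t h1 h2 => by omega, .refl⟩
    | succ n ih =>
      intro hn
      obtain ⟨τ', h1, h2, h3⟩ := ih (by omega)
      have h4 := h1.update_reg hd (j := 0) (t := n + 1) (by omega) hn false
      refine ⟨_, h4, fun t ht ht' => ?_, h3.tail (rel_right false ?_ (hQ _ h1) (hQ _ h4))⟩
      · rcases eq_or_ne t (n + 1) with rfl | hne
        · simp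
        · rw [Function.update_of_ne, h2 t ht (by omega)]
          exact fun h => hne ((square_inj (by omega) (by omega)).1 h).2
      · simp only [delta, seekMove, hC]
        rw [if_neg, ← Nat.cast_succ]
        rw [cast_eq_cast_iff (by omega), Nat.mod_eq_of_lt (by omega)]
        omega
  obtain ⟨τ', h1, h2, h3⟩ := hclear R le_rfl
  refine ⟨τ', h1, fun r hr => ⟨fun j hj => absurd hj (Nat.not_lt_zero _), h2 _ (by omega) (by omega)⟩, ?_⟩
  refine .head' (rel_seek hτ (hQ τ hτ) (by simp [dispatch, hC])) ?_
  refine .trans h3 (Relation.TransGen.to_reflTransGen ?_)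
  have hsq : square R d.inp 0 (R + 1) = homeSquare d.inp + (R + 1) := by
    unfold square
    omega
  have hu : Function.update τ' (homeSquare d.inp + (R + 1)) (τ' (homeSquare d.inp + (R + 1))) = τ' :=
    Function.update_eq_self _ _
  have hlast := rel_left_home (C := C) (l₀ := l₀) (Q := Q) (d := d) (τ := τ') (l := l')
    (q := (.seek, l, ((R + 1 : ℕ) : ZMod (R + 2)))) (i := R + 1) (τ' (homeSquare d.inp + (R + 1)))
    (by omega) ?_ (hQ _ h1) (by rwa [hu]) (by rw [hu]; exact hQ _ h1)
  · rwa [hu, ← hsq] at hlast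
  · simp only [delta, seekMove, hC, if_true]

/-- The tape is set up at the beginning of the computation. -/
theorem simulate_start (R : ℕ) (x : ℕ) (hQ : ∀ τ, Q τ) :
    ∃ τ', Represents R ⟨⟨fun _ => false, false⟩, x + 1, x + 1⟩ τ' ∧
      Relation.TransGen (Rel C R l₀ Q)
        (mk C R l₀ (.start, l, 0) 0 fun i => decide (1 ≤ i ∧ i ≤ x))
        (mk C R l₀ (.home, l, 0) (homeSquare (x + 1)) τ') := by
  set τ₀ : ℕ → Bool := fun i => decide (1 ≤ i ∧ i ≤ x) with h0
  set τ₁ : ℕ → Bool := fun i => decide (2 ≤ i ∧ i ≤ x) with h1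
  set τ₂ : ℕ → Bool := fun i => decide (2 ≤ i ∧ i ≤ x + 1) with h2
  set τ₃ : ℕ → Bool := fun i => decide ((2 ≤ i ∧ i ≤ x + 3) ∨ i = x + 5) with h3
  have hu1 : Function.update τ₀ 1 false = τ₁ := by
    funext i
    simp only [Function.update_apply, h0, h1]
    grind
  have hfirst : Relation.ReflTransGen (Rel C R l₀ Q) (mk C R l₀ (.start, l, 0) 0 τ₀)
      (mk C R l₀ (if x = 0 then .startLast else .startSkip, l, 0) 2 τ₁) := by
    refine .head (rel_right_keep (q' := (.startFirst, l, 0)) rfl (hQ _)) (.single ?_)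
    have := rel_right (l₀ := l₀) (Q := Q) (C := C) (R := R) (q := (.startFirst, l, 0)) (p := 1)
      (τ := τ₀) (q' := (if x = 0 then .startLast else .startSkip, l, 0)) false ?_ (hQ _) (hQ _)
    · rwa [hu1] at this
    · rcases Nat.eq_zero_or_pos x with rfl | hx
      · simp [delta, h0]
      · have h1x : 1 ≤ x := hx
        simp [delta, h0, hx.ne', h1x]
  have hskip : Relation.ReflTransGen (Rel C R l₀ Q) (mk C R l₀ (.start, l, 0) 0 τ₀)
      (mk C R l₀ (.startLast, l, 0) (x + 2) τ₂) := by
    refine hfirst.trans ?_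
    rcases Nat.eq_zero_or_pos x with rfl | hx
    · rw [if_pos rfl, show τ₁ = τ₂ by
        funext i; simp only [h1, h2, decide_eq_decide]; omega]
    · rw [if_neg hx.ne']
      have hscan := scan_right (C := C) (l₀ := l₀) (hQ τ₁)
        (fun _ => ((.startSkip, l, 0) : State L R)) 2 0 (x - 1) ?_
      · refine hscan.tail ?_
        rw [show 2 + (x - 1) = x + 1 by omega]
        have := rel_right (l₀ := l₀) (Q := Q) (C := C) (R := R) (q := (.startSkip, l, 0))
          (p := x + 1) (τ := τ₁) (q' := (.startLast, l, 0)) true ?_ (hQ _) (hQ _)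
        · convert this using 2
          funext i
          simp only [Function.update_apply, h1, h2]
          grind
        · simp [delta, h1]
      · intro k hk
        have : τ₁ (2 + k) = true := by
          simp only [h1, decide_eq_true_eq]
          omega
        simp [delta, this]
  have hrest : Relation.TransGen (Rel C R l₀ Q) (mk C R l₀ (.startLast, l, 0) (x + 2) τ₂)
      (mk C R l₀ (.home, l, 0) (x + 5) τ₃) := by
    refine .head (rel_right (q' := (.startEnd, l, 0)) true rfl (hQ _) (hQ _)) ?_
    refine .head (rel_right (q' := (.startGap, l, 0)) true rfl (hQ _) (hQ _)) ?_
    refine .head (rel_right_keep (q' := (.startHome, l, 0)) rfl (hQ _)) ?_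
    refine .head (rel_left (q' := (.rightEnd, l, 0)) true rfl (hQ _) (hQ _)) ?_
    have := rel_right_keep (l₀ := l₀) (Q := Q) (C := C) (R := R) (q := (.rightEnd, l, 0))
      (p := x + 4) (τ := τ₃) (q' := (.home, l, 0)) rfl (hQ _)
    convert Relation.TransGen.single this using 1
    congr 1
    funext i
    simp only [Function.update_apply, h2, h3]
    grind
  refine ⟨τ₃, ?_, .trans_right hskip hrest⟩
  refine ⟨?_, ?_, fun i hi => ?_, fun i hi hi' => ?_, ?_, fun j hj => ?_, fun j => ?_⟩
  · simp [h3]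
  · simp [h3]
  · dsimp only at hi
    simp only [h3, decide_eq_true_eq]
    omega
  · dsimp only at hi hi'
    simp only [h3, decide_eq_false_iff_not]
    omega
  · simp [h3, homeSquare]
  · have := Nat.mul_le_mul_left (R + 2) hj
    simp only [h3, decide_eq_false_iff_not, square, homeSquare]
    omega
  · simp only [h3, decide_eq_false_iff_not, square, homeSquare]
    omega

end Instructions

end TapeMachine

/-! ### Simulation of runs -/

namespace TapeMachine

open RegisterMachine

section Runs

variable {L : Type} {C : L → Instr L} {R : ℕ} [Finite L] {l₀ : L} {Q : (ℕ → Bool) → Prop}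

/-- The machine simulates one step of the register machine. The tapes in between represent the data
before or after the step, except in a request for input. -/
theorem simulate_step {c : Conf L} {τ : ℕ → Bool} (hC : (C c.1).bound ≤ R)
    (hτ : Represents R c.2.2 τ) (hρ : RepresentsReg R c.2.2.inp c.2.1 τ)
    (hd : c.2.2.rem ≤ c.2.2.inp) (hpos : c.2.2.inp ≠ 0) (hQ : ∀ τ, Represents R c.2.2 τ → Q τ)
    (hQ' : ∀ τ, Represents R (step C c).2.2 τ → Q τ)
    (htake : c.2.2.rem ≠ (step C c).2.2.rem → ∀ τ, Q τ) :
    (step C c).2.2.inp = c.2.2.inp ∧ (step C c).2.2.rem ≤ c.2.2.inp ∧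
    ∃ τ', Represents R (step C c).2.2 τ' ∧ RepresentsReg R c.2.2.inp (step C c).2.1 τ' ∧
      Relation.TransGen (Rel C R l₀ Q) (mk C R l₀ (.home, c.1, 0) (homeSquare c.2.2.inp) τ)
        (mk C R l₀ (.home, (step C c).1, 0) (homeSquare c.2.2.inp) τ') := by
  obtain ⟨l, ρ, d⟩ := c
  unfold step at *
  dsimp only at *
  rcases hCl : C l with ⟨r, l'⟩ | ⟨r, l'⟩ | ⟨r, b, l'⟩ | ⟨b, l'⟩ | ⟨t, l₁, l₂⟩ | l' <;>
    rw [hCl] at hC hQ' htake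
  · exact ⟨rfl, hd, simulate_inc hτ hρ hd hQ hC hCl⟩
  · exact ⟨rfl, hd, simulate_dec hτ hρ hd hQ hC hCl⟩
  · exact ⟨rfl, hd, simulate_write hτ hρ hd hQ hQ' hC hCl⟩
  · exact ⟨rfl, hd, simulate_out hτ hρ hd hQ hQ' hCl⟩
  · cases t with
    | nonzero r => exact ⟨rfl, hd, τ, hτ, hρ, simulate_nonzero hτ hρ (hQ τ hτ) hC hCl⟩
    | bit r => exact ⟨rfl, hd, τ, hτ, hρ, simulate_bit hτ hρ (hQ τ hτ) hC hCl⟩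
    | take =>
      by_cases hrem : d.rem = 0
      · simp only [Instr.exec, Test.eval, hrem, if_true] at htake ⊢
        exact ⟨trivial, le_rfl, simulate_take_false hτ hρ hd (htake (Ne.symm hpos)) hCl hrem⟩
      · simp only [Instr.exec, Test.eval, hrem, if_false] at htake ⊢
        exact ⟨trivial, by omega, simulate_take_true hτ hρ hd (htake (by omega)) hCl hrem⟩
  · exact ⟨rfl, hd, simulate_boot hτ hd hQ hCl⟩

/-- The machine simulates runs of the register machine. -/
theorem simulate_reach {P : Data → Prop} (hC : ∀ l, (C l).bound ≤ R)
    (hQ : ∀ d τ, P d → Represents R d τ → Q τ)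
    (htake : ∀ d d' : Data, P d → P d' → d.rem ≠ d'.rem → ∀ τ, Q τ) {c c' : Conf L}
    (h : Reach (step C) (fun c => P c.2.2) c c') {τ : ℕ → Bool} (hτ : Represents R c.2.2 τ)
    (hρ : RepresentsReg R c.2.2.inp c.2.1 τ) (hd : c.2.2.rem ≤ c.2.2.inp)
    (hpos : c.2.2.inp ≠ 0) :
    c'.2.2.inp = c.2.2.inp ∧ c'.2.2.rem ≤ c.2.2.inp ∧
    ∃ τ', Represents R c'.2.2 τ' ∧ RepresentsReg R c.2.2.inp c'.2.1 τ' ∧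
      Relation.TransGen (Rel C R l₀ Q) (mk C R l₀ (.home, c.1, 0) (homeSquare c.2.2.inp) τ)
        (mk C R l₀ (.home, c'.1, 0) (homeSquare c.2.2.inp) τ') := by
  induction h with
  | single h =>
    obtain ⟨rfl, h1, h2⟩ := h
    exact simulate_step (hC _) hτ hρ hd hpos (fun τ => hQ _ τ h1) (fun τ => hQ _ τ h2)
      (htake _ _ h1 h2)
  | tail _ h ih =>
    obtain ⟨rfl, h1, h2⟩ := h
    obtain ⟨e1, e2, τ', e3, e4, e5⟩ := ih
    rw [← e1] at e2 e4
    obtain ⟨f1, f2, τ'', f3, f4, f5⟩ := simulate_step (l₀ := l₀) (hC _) e3 e4 e2 (by rwa [e1])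
      (fun τ => hQ _ τ h1) (fun τ => hQ _ τ h2) (htake _ _ h1 h2)
    rw [e1] at f1 f2 f4 f5
    exact ⟨f1, f2, τ'', f3, f4, e5.trans f5⟩

theorem exists_iterate_of_transGen {a b : (machine C R l₀).Config}
    (h : Relation.TransGen (Rel C R l₀ Q) a b) :
    ∃ n, 0 < n ∧ (tapeStep C R l₀)^[n] a = b ∧ ∀ i ≤ n, Q ((tapeStep C R l₀)^[i] a).tape :=
  Reach.exists_iterate (Q := fun c : (machine C R l₀).Config => Q c.tape) h

end Runs

/-! ### Limits of runs -/

/-- If from each configuration with the property `A j` one with the property `A (j + 1)` is reached,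
and `G j` holds in between, then a run is divided into intervals accordingly. -/
theorem exists_strictMono_times {X : Type*} {f : X → X} {A G : ℕ → X → Prop} {a : X} {n₀ : ℕ}
    (h0 : A 0 (f^[n₀] a))
    (h : ∀ j c, A j c → ∃ n, 0 < n ∧ A (j + 1) (f^[n] c) ∧ ∀ i ≤ n, G j (f^[i] c)) :
    ∃ T : ℕ → ℕ, StrictMono T ∧ (∀ j, A j (f^[T j] a)) ∧
      ∀ j m, T j ≤ m → m ≤ T (j + 1) → G j (f^[m] a) := by
  choose! N hN hA hG using h
  set T : ℕ → ℕ := fun j => Nat.rec n₀ (fun j t => t + N j (f^[t] a)) j with hT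
  have hTs : ∀ j, T (j + 1) = T j + N j (f^[T j] a) := fun j => rfl
  have hTA : ∀ j, A j (f^[T j] a) := by
    intro j
    induction j with
    | zero => exact h0
    | succ j ih =>
      rw [hTs, Nat.add_comm (T j), Function.iterate_add_apply]
      exact hA j _ ih
  refine ⟨T, strictMono_nat_of_lt_succ fun j => ?_, hTA, fun j m h1 h2 => ?_⟩
  · rw [hTs]
    exact Nat.lt_add_of_pos_right (hN j _ (hTA j))
  · obtain ⟨i, rfl⟩ := Nat.exists_eq_add_of_le h1
    rw [Nat.add_comm (T j), Function.iterate_add_apply]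
    refine hG j _ (hTA j) i ?_
    rw [hTs] at h2
    omega

theorem exists_interval {T : ℕ → ℕ} (hT : StrictMono T) {J m : ℕ} (hm : T J ≤ m) :
    ∃ j, J ≤ j ∧ T j ≤ m ∧ m ≤ T (j + 1) := by
  induction m, hm using Nat.le_induction with
  | base => exact ⟨J, le_rfl, le_rfl, hT.monotone (Nat.le_succ _)⟩
  | succ m _ ih =>
    obtain ⟨j, h1, h2, h3⟩ := ih
    rcases Nat.lt_or_eq_of_le h3 with h3 | h3
    · exact ⟨j, h1, by omega, h3⟩
    · have : T (j + 1) < T (j + 1 + 1) := hT (Nat.lt_succ_self _)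
      exact ⟨j + 1, by omega, by omega, by omega⟩

/-- The limit superior of a sequence of bits `u` can be computed along a subsequence `v`, if between
two terms of the subsequence `u` takes no other values than these two. -/
theorem boolLimsup_eq_of_interval {T : ℕ → ℕ} (hT : StrictMono T) {u v : ℕ → Bool}
    (h : ∀ j, u (T j) = v j)
    (h' : ∀ j m, T j ≤ m → m ≤ T (j + 1) → u m = v j ∨ u m = v (j + 1)) :
    boolLimsup u = boolLimsup v := by
  rw [Bool.eq_iff_iff, boolLimsup_eq_true, boolLimsup_eq_true]
  constructor
  · intro hu N
    obtain ⟨m, hm, hum⟩ := hu (T N)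
    obtain ⟨j, h1, h2, h3⟩ := exists_interval hT hm
    rcases h' j m h2 h3 with h4 | h4
    · exact ⟨j, h1, by rw [← h4, hum]⟩
    · exact ⟨j + 1, by omega, by rw [← h4, hum]⟩
  · intro hv N
    obtain ⟨j, hj, hvj⟩ := hv N
    exact ⟨T j, hj.trans (hT.id_le j), by rw [h, hvj]⟩

/-- The limit of a sequence of tapes that represent the stores of a control unit represents the
limit of these stores. -/
theorem represents_limit {α : Type} [Primcodable α] (D : Controller α) {R x : ℕ}
    {s : Controller.Store} {T : ℕ → ℕ} (hT : StrictMono T) {τ : ℕ → ℕ → Bool}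
    (h : ∀ j, Represents R ⟨(D.conf x s j).2, x + 1, x + 1⟩ (τ (T j)))
    (h' : ∀ j m, T j ≤ m → m ≤ T (j + 1) →
      Represents R ⟨(D.conf x s j).2, x + 1, x + 1⟩ (τ m) ∨
      Represents R ⟨(D.conf x s (j + 1)).2, x + 1, x + 1⟩ (τ m)) :
    Represents R ⟨D.limit x s, x + 1, x + 1⟩ fun i => boolLimsup fun m => τ m i := by
  have hev : ∀ m, T 0 ≤ m → ∃ s', Represents R ⟨s', x + 1, x + 1⟩ (τ m) := by
    intro m hm
    obtain ⟨j, -, h1, h2⟩ := exists_interval hT hm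
    rcases h' j m h1 h2 with h3 | h3 <;> exact ⟨_, h3⟩
  refine ⟨?_, ?_, fun i hi => ?_, fun i hi hi' => ?_, ?_, fun j hj => ?_, fun i => ?_⟩
  · refine boolLimsup_eq_of_interval hT (fun j => (h j).out) fun j m h1 h2 => ?_
    exact (h' j m h1 h2).imp (fun h => h.out) fun h => h.out
  · refine boolLimsup_eq_of_eventually (T 0) fun m hm => ?_
    obtain ⟨_, h1⟩ := hev m hm
    exact h1.gap
  · refine boolLimsup_eq_of_eventually (T 0) fun m hm => ?_
    obtain ⟨_, h1⟩ := hev m hm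
    exact h1.ones i hi
  · refine boolLimsup_eq_of_eventually (T 0) fun m hm => ?_
    obtain ⟨_, h1⟩ := hev m hm
    exact h1.zeros i hi hi'
  · refine boolLimsup_eq_of_eventually (T 0) fun m hm => ?_
    obtain ⟨_, h1⟩ := hev m hm
    exact h1.home
  · refine boolLimsup_eq_of_eventually (T 0) fun m hm => ?_
    obtain ⟨_, h1⟩ := hev m hm
    exact h1.marks j hj
  · refine boolLimsup_eq_of_interval hT (fun j => (h j).mem i) fun j m h1 h2 => ?_
    exact (h' j m h1 h2).imp (fun h => h.mem i) fun h => h.mem i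

end TapeMachine

namespace InfiniteTimeTM

theorem run_zero (M : InfiniteTimeTM) (x : ℕ) : M.run x 0 = M.init x := by
  rw [run, Ordinal.limitRecOn_zero]

theorem run_add_nat (M : InfiniteTimeTM) (x : ℕ) {f : M.Config → M.Config}
    (hf : ∀ c, M.step c = some (f c)) (o : Ordinal.{0}) (m : ℕ) :
    M.run x (o + m) = f^[m] (M.run x o) := by
  induction m with
  | zero => simp
  | succ m ih =>
    rw [Nat.cast_succ, ← add_assoc, Function.iterate_succ_apply', ← ih, run,
      Ordinal.limitRecOn_add_one, ← run, hf]
    rfl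

theorem limitSymbol_add_omega0 (o : Ordinal.{0}) (s : Ordinal.{0} → Bool) :
    limitSymbol (o + Ordinal.omega0) (fun β _ => s β) = boolLimsup fun m => s (o + m) := by
  have hlt : ∀ m : ℕ, o + (m : Ordinal.{0}) < o + Ordinal.omega0 := fun m =>
    (add_lt_add_iff_left o).2 (Ordinal.natCast_lt_omega0 m)
  have hge : ∀ γ, o ≤ γ → γ < o + Ordinal.omega0 → ∃ m : ℕ, γ = o + m := by
    intro γ h1 h2
    obtain ⟨δ, rfl⟩ := exists_add_of_le h1
    obtain ⟨m, rfl⟩ := Ordinal.lt_omega0.1 ((add_lt_add_iff_left o).1 h2)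
    exact ⟨m, rfl⟩
  have key : (∃ β, β < o + Ordinal.omega0 ∧ ∀ γ, γ < o + Ordinal.omega0 → β ≤ γ → s γ = false) ↔
      ∃ N, ∀ j : ℕ, N ≤ j → s (o + j) = false := by
    constructor
    · rintro ⟨β, hβ, h⟩
      obtain ⟨N, hN⟩ : ∃ N : ℕ, β ≤ o + N := by
        rcases le_total o β with h1 | h1
        · obtain ⟨N, rfl⟩ := hge β h1 hβ
          exact ⟨N, le_rfl⟩
        · exact ⟨0, by simpa using h1⟩
      refine ⟨N, fun j hj => h _ (hlt j) (hN.trans ?_)⟩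
      exact (add_le_add_iff_left o).2 (by exact_mod_cast hj)
    · rintro ⟨N, h⟩
      refine ⟨o + N, hlt N, fun γ h1 h2 => ?_⟩
      obtain ⟨m, rfl⟩ := hge γ (le_self_add.trans h2) h1
      refine h m ?_
      exact_mod_cast (add_le_add_iff_left o).1 h2
  unfold limitSymbol
  split_ifs with h
  · obtain ⟨N, hN⟩ := key.1 h
    exact (boolLimsup_eq_of_eventually N hN).symm
  · rw [eq_comm, boolLimsup_eq_true]
    intro N
    by_contra! hc
    exact h (key.2 ⟨N, fun j hj => by simpa using hc j hj⟩)

theorem run_add_omega0 (M : InfiniteTimeTM) (x : ℕ) {f : M.Config → M.Config}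
    (hf : ∀ c, M.step c = some (f c)) (o : Ordinal.{0}) :
    M.run x (o + Ordinal.omega0) =
      ⟨M.limitState, 0, fun i => boolLimsup fun m => (f^[m] (M.run x o)).tape i⟩ := by
  have hl : Order.IsSuccLimit (o + Ordinal.omega0) :=
    Ordinal.isSuccLimit_add o Ordinal.isSuccLimit_omega0
  rw [run, Ordinal.limitRecOn_limit _ _ _ _ hl]
  change M.limitConfig _ (fun β _ => M.run x β) = _
  rw [limitConfig, dif_neg]
  · congr 1
    funext i
    rw [limitSymbol_add_omega0 o fun β => (M.run x β).tape i]
    simp only [run_add_nat M x hf]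
  · rintro ⟨β, hβ, h⟩
    rw [hf] at h
    exact Option.some_ne_none _ h

end InfiniteTimeTM

namespace TapeMachine

open RegisterMachine

/-! ### The machine for a control unit -/

section Controller

variable {α : Type} [Primcodable α]

/-- The code of the register machine that clears its registers, then executes the program `p`, and
then the program `q` again and again. -/
def loopCode (p q : Prog) : Option (p.Label ⊕ q.Label) → Instr (Option (p.Label ⊕ q.Label))
  | none => .boot (some (.inl p.entry))
  | some (.inl l) => p.code (some ∘ Sum.inl) (some (.inr q.entry)) l
  | some (.inr l) => q.code (some ∘ Sum.inr) (some (.inr q.entry)) l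

theorem bound_loopCode_le (p q : Prog) (l : Option (p.Label ⊕ q.Label)) :
    (loopCode p q l).bound ≤ max p.bound q.bound := by
  rcases l with _ | l | l
  · exact Nat.zero_le _
  · exact (p.bound_code_le _ _ l).trans (le_max_left _ _)
  · exact (q.bound_code_le _ _ l).trans (le_max_right _ _)

/-- Each control unit is simulated by an infinite time Turing machine, whose first square holds the
output bit at the end of each stage. -/
theorem exists_machine (D : Controller α) : ∃ M : InfiniteTimeTM, ∀ x k : ℕ,
    (M.run x (Ordinal.omega0 * ((k + 1 : ℕ) : Ordinal.{0}))).tape 0 = (D.stage x (k + 1)).out := by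
  obtain ⟨p, hp⟩ := exists_prog_start D
  obtain ⟨q, hq⟩ := exists_prog_step D
  set C := loopCode p q with hCdef
  set R := max p.bound q.bound with hR
  have hC : ∀ l, (C l).bound ≤ R := bound_loopCode_le p q
  set l₀ : Option (p.Label ⊕ q.Label) := none with hl₀
  set e : Option (p.Label ⊕ q.Label) := some (.inr q.entry) with he
  set f := tapeStep C R l₀ with hf
  -- the configuration at the beginning of the step `j` of a stage
  set A : ℕ → Controller.Store → ℕ → (machine C R l₀).Config → Prop := fun x s j c =>
    ∃ τ, Represents R ⟨(D.conf x s j).2, x + 1, x + 1⟩ τ ∧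
      RepresentsReg R (x + 1) (single (Encodable.encode (D.conf x s j).1)) τ ∧
      c = mk C R l₀ (.home, e, 0) (homeSquare (x + 1)) τ with hA
  have hstart : ∀ x s τ, Represents R ⟨s, x + 1, x + 1⟩ τ → ∃ n,
      A x s 0 (f^[n] (mk C R l₀ (.home, l₀, 0) (homeSquare (x + 1)) τ)) := by
    intro x s τ hτ
    obtain ⟨τ₁, h1, h2, h3⟩ := simulate_boot (C := C) (l₀ := l₀) (Q := fun _ => True)
      (l := l₀) (l' := some (.inl p.entry)) hτ le_rfl (fun _ _ => trivial) rfl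
    have hrun := hp x s C (some ∘ Sum.inl) e fun _ => rfl
    obtain ⟨-, -, τ₂, h4, h5, h6⟩ := simulate_reach (l₀ := l₀) (P := fun _ => True)
      (Q := fun _ => True) hC
      (fun _ _ _ _ => trivial) (fun _ _ _ _ _ _ => trivial) hrun h1 h2 le_rfl
      (Nat.succ_ne_zero x)
    obtain ⟨n, -, hn, -⟩ := exists_iterate_of_transGen (h3.trans h6)
    exact ⟨n, τ₂, h4, h5, hn⟩
  have hstep : ∀ x s j c, A x s j c → ∃ n, 0 < n ∧ A x s (j + 1) (f^[n] c) ∧ ∀ i ≤ n,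
      Represents R ⟨(D.conf x s j).2, x + 1, x + 1⟩ (f^[i] c).tape ∨
      Represents R ⟨(D.conf x s (j + 1)).2, x + 1, x + 1⟩ (f^[i] c).tape := by
    rintro x s j c ⟨τ, h1, h2, rfl⟩
    have hrun := hq (x + 1) (D.conf x s j) C (some ∘ Sum.inr) e fun _ => rfl
    rw [← Controller.conf_succ] at hrun
    obtain ⟨-, -, τ', h3, h4, h5⟩ := simulate_reach (l₀ := l₀)
      (P := fun d => d = ⟨(D.conf x s j).2, x + 1, x + 1⟩ ∨
        d = ⟨(D.conf x s (j + 1)).2, x + 1, x + 1⟩)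
      (Q := fun τ => Represents R ⟨(D.conf x s j).2, x + 1, x + 1⟩ τ ∨
        Represents R ⟨(D.conf x s (j + 1)).2, x + 1, x + 1⟩ τ) hC
      (by
        rintro d τ (rfl | rfl) hd
        · exact Or.inl hd
        · exact Or.inr hd)
      (by rintro d d' (rfl | rfl) (rfl | rfl) hne <;> exact absurd rfl hne)
      hrun h1 h2 le_rfl (Nat.succ_ne_zero x)
    obtain ⟨n, hn, hn', hQ⟩ := exists_iterate_of_transGen h5
    exact ⟨n, hn, ⟨τ', h3, h4, hn'⟩, hQ⟩
  refine ⟨machine C R l₀, fun x k => ?_⟩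
  have hM : ∀ c, (machine C R l₀).step c = some (f c) := step_machine C R l₀
  -- the configuration at the end of the stage `k`
  have hlim : ∀ k : ℕ, (∃ n τ, Represents R ⟨D.stage x k, x + 1, x + 1⟩ τ ∧
      f^[n] ((machine C R l₀).run x (Ordinal.omega0 * (k : Ordinal.{0}))) =
        mk C R l₀ (.home, l₀, 0) (homeSquare (x + 1)) τ) →
      ∃ τ, Represents R ⟨D.stage x (k + 1), x + 1, x + 1⟩ τ ∧
        (machine C R l₀).run x (Ordinal.omega0 * ((k + 1 : ℕ) : Ordinal.{0})) =
          mk C R l₀ (.right, l₀, 0) 0 τ := by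
    rintro k ⟨n, τ, hτ, hn⟩
    obtain ⟨n', hn'⟩ := hstart x _ τ hτ
    rw [← hn, ← Function.iterate_add_apply] at hn'
    obtain ⟨T, hT, hTA, hTG⟩ := exists_strictMono_times (G := fun j c =>
      Represents R ⟨(D.conf x (D.stage x k) j).2, x + 1, x + 1⟩ c.tape ∨
      Represents R ⟨(D.conf x (D.stage x k) (j + 1)).2, x + 1, x + 1⟩ c.tape) hn' (hstep x (D.stage x k))
    refine ⟨_, represents_limit D hT (fun j => ?_) hTG, ?_⟩
    · obtain ⟨τ', h1, -, h2⟩ := hTA j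
      rw [h2]
      exact h1
    · rw [Nat.cast_succ, mul_add, mul_one]
      exact InfiniteTimeTM.run_add_omega0 _ x hM _
  -- each stage, the first one and those after a limit, comes to the home square
  have hret : ∀ k : ℕ, ∃ n τ, Represents R ⟨D.stage x k, x + 1, x + 1⟩ τ ∧
      f^[n] ((machine C R l₀).run x (Ordinal.omega0 * (k : Ordinal.{0}))) =
        mk C R l₀ (.home, l₀, 0) (homeSquare (x + 1)) τ := by
    intro k
    induction k with
    | zero =>
      obtain ⟨τ, h1, h2⟩ := simulate_start (C := C) (l₀ := l₀) (l := l₀) (Q := fun _ => True) R x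
        fun _ => trivial
      obtain ⟨n, -, hn, -⟩ := exists_iterate_of_transGen h2
      refine ⟨n, τ, h1, ?_⟩
      rw [Nat.cast_zero, mul_zero, InfiniteTimeTM.run_zero]
      exact hn
    | succ k ih =>
      obtain ⟨τ, h1, h2⟩ := hlim k ih
      have h3 := return_gap (C := C) (l₀ := l₀) (l := l₀) (Q := fun _ => True) h1 le_rfl trivial
      obtain ⟨n, -, hn, -⟩ := exists_iterate_of_transGen h3
      refine ⟨n + 1, τ, h1, ?_⟩
      rw [h2, Function.iterate_succ_apply]
      have h4 : f (mk C R l₀ (.right, l₀, 0) 0 τ) = mk C R l₀ (.rightGap, l₀, 0) 1 τ :=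
        (rel_right_keep (l₀ := l₀) (Q := fun _ => True) rfl trivial).1
      rw [h4]
      exact hn
  obtain ⟨τ, h1, h2⟩ := hlim k (hret k)
  rw [h2]
  exact h1.out

end Controller

end TapeMachine

theorem mainTheorem3 (n : ℕ) (hn : 1 ≤ n) :
    ArithmeticalHierarchy.deltaPredicates (n + 1) ⊆
      InfiniteTimeTM.predicatesDecidedInTime (Ordinal.omega0 * (n : Ordinal.{0})) := by
  intro P hP
  obtain ⟨l, rfl⟩ := Nat.exists_eq_add_of_le' hn
  obtain ⟨a, ha, hPa⟩ := ArithmeticalHierarchy.exists_forall_exists_alternation hP.2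
  obtain ⟨M, hM⟩ := TapeMachine.exists_machine (ArithmeticalHierarchy.altController a ha l)
  refine ⟨M, fun x => ?_⟩
  rw [hM, hPa]
  exact ArithmeticalHierarchy.altController_stage_out ha
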